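/- Let $k$ be a field of characteristic $0$, $Y$ a smooth scheme over $k$, $\mathcal I\subset\mathcal O_Y$ a (quasi-)coherent ideal sheaf and $p\in Y$ a point. For an ideal sheaf $\mathcal I$ let $\mathcal D^{\le 1}\mathcal I$ be the ideal generated by $\mathcal I$ and the images of sections of $\mathcal I$ under $k$-derivations of $\mathcal O_Y$, let $\mathcal D^{\le i}$ be its $i$-fold iterate, and for an integer $a\ge 1$ let the coefficient ideal be $$C(\mathcal I,a)=\sum_{\sum_{i=0}^{a-1}(a-i)b_i\ \ge\ a!}\mathcal I^{b_0}(\mathcal D^{\le 1}\mathcal I)^{b_1}\cdots(\mathcal D^{\le a-1}\mathcal I)^{b_{a-1}} .$$ Let $\operatorname{ord}_p(\mathcal I)=\max\{a:\mathcal I_p\subseteq\mathfrak m_p^a\}$ (infinite if $\mathcal I_p=0$). The invariant $\operatorname{inv}_p(\mathcal I)$ is the finite sequence of nonnegative rational numbers defined recursively as follows. If $\mathcal I_p=(0)$ it is the empty sequence; if $\mathcal I_p=(1)$ it is $(0)$. Otherwise put $a_1=\operatorname{ord}_p(\mathcal I)\ge 1$, choose a maximal contact element $x_1\in\mathcal D^{\le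 a_1-1}\mathcal I_p$, $x_1\in\mathfrak m_p\smallsetminus\mathfrak m_p^2$, and let $$\operatorname{inv}_p(\mathcal I)=\Bigl(a_1,\ \tfrac{1}{(a_1-1)!}\operatorname{inv}_p\bigl(C(\mathcal I,a_1)|_{V(x_1)}\bigr)\Bigr)$$ (concatenation), where the invariant on the right is formed on the smooth hypersurface germ $V(x_1)$. Then $\operatorname{inv}_p(\mathcal I)$ is well defined: such choices can be made, and the resulting sequence does not depend on them. Moreover: 1. $\operatorname{inv}_p(\mathcal I^m)=m\cdot\operatorname{inv}_p(\mathcal I)$ for every integer $m\ge 1$; 2. if $\operatorname{ord}_p(\mathcal I)=a_1$ with $1\le a_1<\infty$, then $\operatorname{inv}_p(C(\mathcal I,a_1))=(a_1-1)!\cdot\operatorname{inv}_p(\mathcal I)$. -/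

import Mathlib

open AlgebraicGeometry CategoryTheory TopologicalSpace
open scoped Nat

universe u v

/-- `𝒟^{≤1} I`: the ideal generated by the elements of `I` together with all `D g`, for `g ∈ I`
and `D` a `k`-linear derivation of `R`. For `R` smooth over a field `k` of characteristic zero,
`i` iterations of this operation give the ideal `𝒟^{≤i} I` generated by the values on `I` of the
differential operators of order at most `i`. -/
def derivIdeal (k : Type u) [CommRing k] {R : Type v} [CommRing R] [Algebra k R] (I : Ideal R) :
    Ideal R :=
  Ideal.span ((I : Set R) ∪ {h : R | ∃ (D : Derivation k R R) (g : R), g ∈ I ∧ h = D g})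

/-- `𝒟^{≤1}` commutes with localization, for algebras with finitely presented differentials. -/
theorem derivIdeal_map (k : Type u) [CommRing k] {A : Type v} {B : Type v} [CommRing A]
    [CommRing B] [Algebra k A] [Algebra k B] [Algebra A B] [IsScalarTower k A B]
    (M : Submonoid A) [IsLocalization M B] [Module.FinitePresentation A (Ω[A⁄k])]
    (I : Ideal A) :
    (derivIdeal k I).map (algebraMap A B) = derivIdeal k (I.map (algebraMap A B)) := by
  apply le_antisymm
  · rw [derivIdeal, Ideal.map_span, Ideal.span_le]
    rintro _ ⟨h, hh, rfl⟩
    apply Ideal.subset_span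
    rcases hh with hh | ⟨D, g, hg, rfl⟩
    · exact Or.inl (Ideal.mem_map_of_mem _ hh)
    · right
      let τ : Ω[A⁄k] →ₗ[A] B := (Algebra.linearMap A B).comp D.liftKaehlerDifferential
      let ψ : Ω[B⁄k] →ₗ[A] B := IsLocalizedModule.lift M (KaehlerDifferential.map k k A B) τ
        (IsLocalizedModule.map_units (Algebra.linearMap A B))
      let ψ' : Ω[B⁄k] →ₗ[B] B := LinearMap.extendScalarsOfIsLocalization M B ψ
      refine ⟨ψ'.compDer (KaehlerDifferential.D k B), algebraMap A B g,
        Ideal.mem_map_of_mem _ hg, ?_⟩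
      have h1 : ψ (KaehlerDifferential.map k k A B (KaehlerDifferential.D k A g)) =
          τ (KaehlerDifferential.D k A g) := IsLocalizedModule.lift_apply M _ _ _ _
      rw [KaehlerDifferential.map_D] at h1
      have h2 : τ (KaehlerDifferential.D k A g) = algebraMap A B (D g) := by simp [τ]
      exact (h1.trans h2).symm
  · have key : ∀ x ∈ I.map (algebraMap A B), x ∈ (derivIdeal k I).map (algebraMap A B) :=
      fun x hx => Ideal.map_mono (fun y hy => Ideal.subset_span (Or.inl hy)) hx
    conv_lhs => rw [derivIdeal]
    rw [Ideal.span_le]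
    rintro h (hh | ⟨D, g, hg, rfl⟩)
    · exact key h hh
    · obtain ⟨⟨a, s⟩, has⟩ := (IsLocalization.mem_map_algebraMap_iff M B).1 hg
      have hs : IsUnit (algebraMap A B s) := IsLocalization.map_units B s
      let δ : Ω[A⁄k] →ₗ[A] B :=
        (D.liftKaehlerDifferential.restrictScalars A).comp (KaehlerDifferential.map k k A B)
      obtain ⟨δ', t, ht⟩ := Module.FinitePresentation.exists_lift_of_isLocalizedModule M
        (Algebra.linearMap A B) δ
      have htu : IsUnit (algebraMap A B t) := IsLocalization.map_units B t
      let D₀ : Derivation k A A := δ'.compDer (KaehlerDifferential.D k A)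
      have h1 : algebraMap A B (D₀ a) = algebraMap A B t * D (algebraMap A B a) := by
        have := LinearMap.congr_fun ht (KaehlerDifferential.D k A a)
        simpa [δ, D₀, Submonoid.smul_def, Algebra.smul_def] using this
      have h2 : D (algebraMap A B a) ∈ (derivIdeal k I).map (algebraMap A B) := by
        rw [← Ideal.unit_mul_mem_iff_mem _ htu, ← h1]
        exact Ideal.mem_map_of_mem _ (Ideal.subset_span (Or.inr ⟨D₀, a, a.2, rfl⟩))
      have h3 : algebraMap A B s * D g =
          D (algebraMap A B a) - g * D (algebraMap A B s) := by
        have : D (g * algebraMap A B s) = D (algebraMap A B a) := by rw [has]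
        rw [← this, D.leibniz, smul_eq_mul, smul_eq_mul]; ring
      change D g ∈ (derivIdeal k I).map (algebraMap A B)
      rw [← Ideal.unit_mul_mem_iff_mem _ hs, h3]
      exact sub_mem h2 (Ideal.mul_mem_right _ _ (key g hg))

/-- The degree `j` piece of the graded algebra generated by placing `𝒟^{≤ a-i} I` in degree `i`:
the sum of all monomials `I^{b₀} (𝒟^{≤1} I)^{b₁} ⋯ (𝒟^{≤a-1} I)^{b_{a-1}}` in the ideals
`𝒟^{≤i} I` whose weighted degree `∑ (a-i) bᵢ` is at least `j`. Here `S` is the ordered monoid of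
ideals of a ring, or of ideal sheaves on a scheme, and `𝒟 : S → S` is the operation `𝒟^{≤1}`. -/
def gradedPiece {S : Type v} [CommMonoid S] [CompleteLattice S] (𝒟 : S → S) (I : S) (a j : ℕ) :
    S :=
  ⨆ (b : Fin a → ℕ) (_ : j ≤ ∑ i : Fin a, (a - (i : ℕ)) * b i), ∏ i : Fin a, (𝒟^[i] I) ^ b i

/-- The (saturated) coefficient ideal `C(I, a)`: the piece of degree `a!`. -/
def coeffIdeal (k : Type u) [CommRing k] {R : Type v} [CommRing R] [Algebra k R] (I : Ideal R)
    (a : ℕ) : Ideal R :=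
  gradedPiece (derivIdeal k) I a a !

/-- The order `max {a : I ⊆ 𝔪 ^ a}` of `I`, equal to `⊤` if there is no maximum. -/
noncomputable def idealOrder {R : Type v} [CommRing R] (𝔪 I : Ideal R) : ℕ∞ :=
  ⨆ (a : ℕ) (_ : I ≤ 𝔪 ^ a), (a : ℕ∞)

/-- `IsInvariantOf k R 𝔪 I l`, for a local `k`-algebra `R` with maximal ideal `𝔪`: the sequence `l`
is obtained from `I` by successive choices of maximal contact elements. The invariant of the zero
ideal is `()`, the invariant of the unit ideal is `(0)`, and if `I` is of order `a ≥ 1` and `x` is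
a maximal contact element (an element of `𝒟^{≤a-1} I` which is a regular parameter) then the
invariant of `I` is the concatenation of `a` and `1/(a-1)!` times the invariant of the restriction
of `C(I, a)` to `V(x)`. -/
inductive IsInvariantOf (k : Type u) [CommRing k] :
    ∀ (R : Type v) [CommRing R] [Algebra k R], Ideal R → Ideal R → List ℚ → Prop
  | zero {R : Type v} [CommRing R] [Algebra k R] (𝔪 : Ideal R) : IsInvariantOf k R 𝔪 ⊥ []
  | unit {R : Type v} [CommRing R] [Algebra k R] (𝔪 : Ideal R) : IsInvariantOf k R 𝔪 ⊤ [0]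
  | step {R : Type v} [CommRing R] [Algebra k R] (𝔪 I : Ideal R) (a : ℕ) (x : R) (l : List ℚ)
      (one_le : 1 ≤ a) (order_eq : idealOrder 𝔪 I = a)
      (mem_deriv : x ∈ (derivIdeal k)^[a - 1] I) (mem : x ∈ 𝔪) (notMem : x ∉ 𝔪 ^ 2)
      (restriction : IsInvariantOf k (R ⧸ Ideal.span {x})
        (𝔪.map (Ideal.Quotient.mk (Ideal.span {x})))
        ((coeffIdeal k I a).map (Ideal.Quotient.mk (Ideal.span {x}))) l) :
      IsInvariantOf k R 𝔪 I ((a : ℚ) :: l.map (fun c => c / ((a - 1)! : ℚ)))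

section Schemes

variable {k : Type u} [Field k] {Y : Scheme.{u}}

/-- The `k`-algebra structure on the sections over `U` of a `k`-scheme. -/
noncomputable abbrev sectionsAlgebra (f : Y ⟶ Spec (.of k)) (U : Y.Opens) : Algebra k Γ(Y, U) :=
  ((Scheme.ΓSpecIso (.of k)).inv ≫ f.appTop ≫
    Y.presheaf.map (homOfLE le_top).op).hom.toAlgebra

/-- The `k`-algebra structure on the local ring at `p` of a `k`-scheme. -/
noncomputable abbrev stalkAlgebra (f : Y ⟶ Spec (.of k)) (p : Y) : Algebra k (Y.presheaf.stalk p) :=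
  ((Scheme.ΓSpecIso (.of k)).inv ≫ f.appTop ≫ Y.presheaf.germ ⊤ p trivial).hom.toAlgebra

/-- `𝒟^{≤1} I` for an ideal sheaf `I` on a smooth `k`-scheme: on affine opens it is the ideal
generated by `I` and the values on `I` of the `k`-derivations. -/
noncomputable def derivSheaf (f : Y ⟶ Spec (.of k)) [Smooth f] (I : Y.IdealSheafData) :
    Y.IdealSheafData where
  ideal U := letI := sectionsAlgebra f U.1; derivIdeal k (I.ideal U)
  map_ideal_basicOpen U g := by
    let := sectionsAlgebra f U.1
    let := sectionsAlgebra f (Y.basicOpen g)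
    let : Algebra Γ(Y, U) Γ(Y, Y.basicOpen g) :=
      (Y.presheaf.map (homOfLE <| Y.basicOpen_le g).op).hom.toAlgebra
    have : IsScalarTower k Γ(Y, U) Γ(Y, Y.basicOpen g) := .of_algebraMap_eq' (by
      simp only [RingHom.algebraMap_toAlgebra]
      rw [← CommRingCat.hom_comp, Category.assoc, Category.assoc, ← Y.presheaf.map_comp]
      rfl)
    have : IsLocalization.Away g Γ(Y, Y.basicOpen g) := U.2.isLocalization_basicOpen g
    have : Algebra.Smooth k Γ(Y, U) :=
      RingHom.Smooth.respectsIso.2 (f.appLE ⊤ U.1 le_top).hom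
        (Scheme.ΓSpecIso (.of k)).symm.commRingCatIsoToRingEquiv
        (Scheme.Hom.smooth_appLE f (isAffineOpen_top _) U.2 le_top)
    have h := derivIdeal_map k (B := Γ(Y, Y.basicOpen g)) (Submonoid.powers g) (I.ideal U)
    exact h.trans (congrArg (derivIdeal k) (I.map_ideal_basicOpen U g))

/-- The coefficient ideal sheaf `C(I, a)`. -/
noncomputable def coeffSheaf (f : Y ⟶ Spec (.of k)) [Smooth f] (I : Y.IdealSheafData) (a : ℕ) :
    Y.IdealSheafData :=
  gradedPiece (derivSheaf f) I a a !

/-- The stalk `I_p` of an ideal sheaf, as an ideal of the local ring at `p`. -/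
noncomputable def stalkIdeal (I : Y.IdealSheafData) (p : Y) : Ideal (Y.presheaf.stalk p) :=
  ⨆ (U : Y.affineOpens) (h : p ∈ U.1), (I.ideal U).map (Y.presheaf.germ U.1 p h).hom

/-- `ord_p(I) = max {a : I_p ⊆ 𝔪_p ^ a}`. -/
noncomputable def orderAt (I : Y.IdealSheafData) (p : Y) : ℕ∞ :=
  idealOrder (IsLocalRing.maximalIdeal (Y.presheaf.stalk p)) (stalkIdeal I p)

/-- `l` is the value of `inv_p(I)` for some choice of maximal contact elements. -/
def IsInvariantAt (f : Y ⟶ Spec (.of k)) (I : Y.IdealSheafData) (p : Y) (l : List ℚ) : Prop :=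
  letI := stalkAlgebra f p
  IsInvariantOf k (Y.presheaf.stalk p) (IsLocalRing.maximalIdeal (Y.presheaf.stalk p))
    (stalkIdeal I p) l

/-- The invariant `inv_p(I)`, computed with some choice of maximal contact elements. -/
noncomputable def invAt (f : Y ⟶ Spec (.of k)) (I : Y.IdealSheafData) (p : Y) : List ℚ :=
  Classical.epsilon (IsInvariantAt f I p)

end Schemes

/-! The invariant does not depend on choices because it equals a quantity defined without them. Call
`b` the type of an admissible center of `I` if, for some partial regular system of parameters `x`
with `x i` of weight `1 / b i`, all elements of `I` have weighted order at least `1`. For a proper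
ideal, every sequence produced by the recursion is the lexicographically largest such type
(`IsInvariantOf.isMaxAdmissible`), and a maximum is unique.

Upper bound (`IsAdmissible.lexLE_of_restriction`): a derivation lowers weighted order by at most the
largest weight. Hence, for a center of type beginning with `a`, a maximal contact element has at
least the largest weight and can be exchanged for a parameter of that weight
(`IsParameterFamily.exchange`). The remaining parameters give an admissible center for `C(I, a)`
restricted to `V(x)`, with type scaled by `(a-1)!`.

Lower bound (`IsAdmissible.of_restriction`): weighted order can be tested on the Taylor coefficients
along `x`, restricted to `V(x)` (`weightedIdeal.mem_cons_iff_taylor`). For `f ∈ I` and `D x = 1`,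
the power of `D^[j] f` with exponent `a!/(a-j)` lies in `C(I, a)`. Roots can be extracted because
weighted order is multiplicative (`IsParameterFamily.isValuative`).

Multiplicativity also shows that the centers of `I ^ m` are those of `I` rescaled, which is the
first formula. The second holds because `C(I, a)` contains `I ^ (a-1)!` and is still admissible for
the rescaled maximal center of `I`.

Smoothness enters only through `HasDualDerivations`, a condition inherited by smooth hypersurface
germs. It also yields a derivation of Euler type, hence maximal contact elements in characteristic
zero; the recursion stops because the dimension drops. -/

/-! ### Ideals of elements of given weighted order -/

section WeightedIdeal

variable {ι : Type*} [Fintype ι] {R : Type v} [CommRing R]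

/-- The ideal generated by the monomials in `x` of weighted degree at least `n`, where `x i` has
weight `w i`. -/
def weightedIdeal (x : ι → R) (w : ι → ℕ) (n : ℕ) : Ideal R :=
  Ideal.span {y | ∃ c : ι → ℕ, n ≤ ∑ i, c i * w i ∧ y = ∏ i, x i ^ c i}

namespace weightedIdeal

variable {x : ι → R} {w : ι → ℕ} {m n : ℕ}

theorem prod_mem (c : ι → ℕ) (h : n ≤ ∑ i, c i * w i) : ∏ i, x i ^ c i ∈ weightedIdeal x w n :=
  Ideal.subset_span ⟨c, h, rfl⟩

theorem zero : weightedIdeal x w 0 = ⊤ := by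
  rw [Ideal.eq_top_iff_one]
  simpa using prod_mem (x := x) (w := w) (n := 0) (fun _ => 0) (Nat.zero_le _)

theorem anti (h : m ≤ n) : weightedIdeal x w n ≤ weightedIdeal x w m := by
  refine Ideal.span_mono ?_
  rintro _ ⟨c, hc, rfl⟩
  exact ⟨c, h.trans hc, rfl⟩

theorem self_mem (i : ι) : x i ∈ weightedIdeal x w (w i) := by
  classical
  have := prod_mem (x := x) (w := w) (n := w i) (Pi.single i 1)
    (by simp [Pi.single_apply])
  simpa [Pi.single_apply, pow_ite] using this

theorem mul_le : weightedIdeal x w m * weightedIdeal x w n ≤ weightedIdeal x w (m + n) := by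
  rw [weightedIdeal, weightedIdeal, Ideal.span_mul_span', Ideal.span_le]
  rintro _ ⟨_, ⟨c, hc, rfl⟩, _, ⟨d, hd, rfl⟩, rfl⟩
  have := prod_mem (x := x) (w := w) (n := m + n) (c + d)
    (by simpa [add_mul, Finset.sum_add_distrib] using add_le_add hc hd)
  simpa [pow_add, Finset.prod_mul_distrib] using this

theorem mul_mem {a b : R} (ha : a ∈ weightedIdeal x w m) (hb : b ∈ weightedIdeal x w n) :
    a * b ∈ weightedIdeal x w (m + n) :=
  mul_le (Ideal.mul_mem_mul ha hb)

theorem pow_mem {a : R} (ha : a ∈ weightedIdeal x w m) (e : ℕ) :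
    a ^ e ∈ weightedIdeal x w (e * m) := by
  induction e with
  | zero => simp [zero]
  | succ e ih => rw [pow_succ, add_mul, one_mul]; exact mul_mem ih ha

/-- The weighted ideals form the smallest multiplicative filtration containing each `x i` in
degree `w i`. -/
theorem le_of_filtration (N : ℕ → Ideal R) (h0 : N 0 = ⊤) (hanti : Antitone N)
    (hmul : ∀ m n, N m * N n ≤ N (m + n)) (hx : ∀ i, x i ∈ N (w i)) (n : ℕ) :
    weightedIdeal x w n ≤ N n := by
  have hpow : ∀ i e, x i ^ e ∈ N (e * w i) := by
    intro i e
    induction e with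
    | zero => simp [h0]
    | succ e ih =>
      rw [pow_succ, add_mul, one_mul]; exact hmul _ _ (Ideal.mul_mem_mul ih (hx i))
  rw [weightedIdeal, Ideal.span_le]
  rintro _ ⟨c, hc, rfl⟩
  refine hanti hc ?_
  classical
  induction (Finset.univ : Finset ι) using Finset.induction_on with
  | empty => simp [h0]
  | insert i s hi ih =>
    rw [Finset.prod_insert hi, Finset.sum_insert hi]
    exact hmul _ _ (Ideal.mul_mem_mul (hpow i _) ih)

theorem le_of_mem {κ : Type*} [Fintype κ] {y : κ → R} {v : κ → ℕ}
    (h : ∀ i, x i ∈ weightedIdeal y v (w i)) (n : ℕ) :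
    weightedIdeal x w n ≤ weightedIdeal y v n :=
  le_of_filtration _ zero (fun _ _ => anti) (fun _ _ => mul_le) h n

theorem map {S : Type*} [CommRing S] (g : R →+* S) :
    (weightedIdeal x w n).map g = weightedIdeal (g ∘ x) w n := by
  rw [weightedIdeal, weightedIdeal, Ideal.map_span]
  congr 1
  ext z
  constructor
  · rintro ⟨_, ⟨c, hc, rfl⟩, rfl⟩
    exact ⟨c, hc, by simp⟩
  · rintro ⟨c, hc, rfl⟩
    exact ⟨_, ⟨c, hc, rfl⟩, by simp⟩

theorem eq_bot [IsEmpty ι] (hn : n ≠ 0) : weightedIdeal x w n = ⊥ := by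
  rw [weightedIdeal, Ideal.span_eq_bot]
  rintro _ ⟨c, hc, rfl⟩
  simp at hc
  omega

/-- A monomial of ordinary degree at most `j` has weight at most `j * W`. -/
theorem le_pow {𝔪 : Ideal R} (hx : ∀ i, x i ∈ 𝔪) {W : ℕ} (hw : ∀ i, w i ≤ W) {j : ℕ}
    (hj : j * W < n) : weightedIdeal x w n ≤ 𝔪 ^ (j + 1) := by
  rw [weightedIdeal, Ideal.span_le]
  rintro _ ⟨c, hc, rfl⟩
  have h1 : ∑ i, c i * w i ≤ (∑ i, c i) * W := by
    rw [Finset.sum_mul]; exact Finset.sum_le_sum fun i _ => Nat.mul_le_mul_left _ (hw i)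
  have h2 : j < ∑ i, c i := by
    by_contra! h
    have := Nat.mul_le_mul_right W h
    omega
  refine Ideal.pow_le_pow_right h2 ?_
  rw [← Finset.prod_pow_eq_pow_sum]
  exact Ideal.prod_mem_prod fun i _ => Ideal.pow_mem_pow (hx i) _

theorem smul {e : ℕ} (he : 0 < e) :
    weightedIdeal x (fun i => e * w i) (e * n) = weightedIdeal x w n := by
  unfold weightedIdeal
  congr 1
  ext z
  refine exists_congr fun c => and_congr_left fun _ => ?_
  have : ∑ i, c i * (e * w i) = e * ∑ i, c i * w i := by
    rw [Finset.mul_sum]; exact Finset.sum_congr rfl fun i _ => mul_left_comm _ _ _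
  rw [this, Nat.mul_le_mul_left_iff he]

theorem deriv {k : Type*} [CommRing k] [Algebra k R] (D : Derivation k R R) {W : ℕ}
    (hw : ∀ i, w i ≤ W) {a : R} (ha : a ∈ weightedIdeal x w n) :
    D a ∈ weightedIdeal x w (n - W) := by
  -- The elements that satisfy the claim themselves form a multiplicative filtration, so it is
  -- enough to check the generators `x i`.
  let N : ℕ → Ideal R := fun n =>
    { carrier := {a | a ∈ weightedIdeal x w n ∧ D a ∈ weightedIdeal x w (n - W)}
      add_mem' := fun ha hb => ⟨add_mem ha.1 hb.1, by rw [map_add]; exact add_mem ha.2 hb.2⟩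
      zero_mem' := ⟨zero_mem _, by simp⟩
      smul_mem' := fun r a ha => ⟨Ideal.mul_mem_left _ _ ha.1, by
        rw [smul_eq_mul, D.leibniz, smul_eq_mul, smul_eq_mul]
        exact add_mem (Ideal.mul_mem_left _ _ ha.2)
          (Ideal.mul_mem_right _ _ (anti (Nat.sub_le _ _) ha.1))⟩ }
  refine (le_of_filtration N ?_ ?_ ?_ ?_ n ha).2
  · rw [Ideal.eq_top_iff_one]
    exact ⟨by simp [zero], by simp⟩
  · intro m n h a ha
    exact ⟨anti h ha.1, anti (Nat.sub_le_sub_right h W) ha.2⟩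
  · intro m n
    rw [Ideal.mul_le]
    intro a ha b hb
    refine ⟨mul_mem ha.1 hb.1, ?_⟩
    rw [D.leibniz, smul_eq_mul, smul_eq_mul]
    exact add_mem (anti (by omega) (mul_mem ha.1 hb.2)) (anti (by omega) (mul_mem hb.1 ha.2))
  · intro i
    refine ⟨self_mem i, ?_⟩
    rw [Nat.sub_eq_zero_of_le (hw i), zero]
    trivial

theorem deriv_iterate {k : Type*} [CommRing k] [Algebra k R] (D : Derivation k R R) {W : ℕ}
    (hw : ∀ i, w i ≤ W) {a : R} (ha : a ∈ weightedIdeal x w n) (j : ℕ) :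
    D^[j] a ∈ weightedIdeal x w (n - j * W) := by
  induction j with
  | zero => simpa using ha
  | succ j ih =>
    rw [Function.iterate_succ_apply', add_mul, one_mul, ← Nat.sub_sub]
    exact deriv D hw ih

section Cons

variable {l : ℕ} {z : R} {y : Fin l → R} {v : ℕ} {s : Fin l → ℕ}

theorem le_cons : weightedIdeal y s n ≤ weightedIdeal (Fin.cons z y : Fin (l + 1) → R)
    (Fin.cons v s : Fin (l + 1) → ℕ) n := by
  refine le_of_mem (fun i => ?_) n
  simpa using self_mem
    (x := (Fin.cons z y : Fin (l + 1) → R)) (w := (Fin.cons v s : Fin (l + 1) → ℕ)) i.succ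

theorem head_mem : z ∈ weightedIdeal (Fin.cons z y : Fin (l + 1) → R)
    (Fin.cons v s : Fin (l + 1) → ℕ) v := by
  simpa using self_mem
    (x := (Fin.cons z y : Fin (l + 1) → R)) (w := (Fin.cons v s : Fin (l + 1) → ℕ)) 0

theorem map_cons {S : Type*} [CommRing S] (g : R →+* S) (hz : g z = 0) :
    (weightedIdeal (Fin.cons z y : Fin (l + 1) → R) (Fin.cons v s : Fin (l + 1) → ℕ) n).map g =
      weightedIdeal (g ∘ y) s n := by
  refine le_antisymm ?_ ?_
  · rw [map]
    refine le_of_mem (fun i => ?_) n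
    refine Fin.cases ?_ (fun i => ?_) i
    · simp [hz]
    · simpa using self_mem (x := g ∘ y) (w := s) i
  · rw [← map]
    exact Ideal.map_mono le_cons

end Cons

end weightedIdeal

end WeightedIdeal

/-! ### Taylor expansion along a coordinate and multiplicativity of weighted order -/

section Taylor

variable {k : Type u} [Field k] [CharZero k] {R : Type v} [CommRing R] [Algebra k R]

theorem isUnit_natCast_of_charZero (k : Type u) [Field k] [CharZero k] {R : Type v} [CommRing R]
    [Algebra k R] {n : ℕ} (hn : n ≠ 0) : IsUnit (n : R) := by
  rw [← map_natCast (algebraMap k R) n]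
  exact (IsUnit.mk0 _ (Nat.cast_ne_zero.2 hn)).map _

theorem Derivation.iterate_leibniz {k : Type u} [CommRing k] {R : Type v} [CommRing R]
    [Algebra k R] (D : Derivation k R R) (n : ℕ) (a b : R) :
    D^[n] (a * b) =
      ∑ ij ∈ Finset.HasAntidiagonal.antidiagonal n, n.choose ij.1 • (D^[ij.1] a * D^[ij.2] b) := by
  induction n with
  | zero => simp
  | succ n ih =>
    rw [Finset.sum_antidiagonal_choose_succ_nsmul (M := R) (fun i j => D^[i] a * D^[j] b) n]
    simp only [Function.iterate_succ_apply', ih, map_sum, map_nsmul, D.leibniz, smul_eq_mul,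
      nsmul_add, Finset.sum_add_distrib]
    congr 1
    refine Finset.sum_congr rfl fun ij hij => ?_
    rw [mul_comm, Nat.choose_symm_of_eq_add (Finset.HasAntidiagonal.mem_antidiagonal.1 hij).symm]

/-- If `D x = 1` and `J` is an ideal containing a power of `x` and stable under `x D`, then
`1 + x D` is injective modulo `J`. -/
theorem mem_of_add_mul_derivation_mem (D : Derivation k R R) {x : R} (hD : D x = 1) {J : Ideal R}
    (hJ : ∀ a ∈ J, x * D a ∈ J) {N : ℕ} (hN : x ^ N ∈ J) {r : R} (h : r + x * D r ∈ J) :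
    r ∈ J := by
  -- Modulo `J`, `r` agrees with `-x D r`. Iterating this makes `n! r` a multiple of `x ^ n`, and
  -- `n!` is invertible in characteristic zero.
  have key : ∀ n : ℕ, ∃ s, (n ! : R) * r - x ^ n * s ∈ J := by
    intro n
    induction n with
    | zero => exact ⟨r, by simp⟩
    | succ n ih =>
      obtain ⟨s, hs⟩ := ih
      refine ⟨-D s, ?_⟩
      have h1 := hJ _ hs
      have h2 := J.mul_mem_left (n ! : R) h
      have h3 := J.mul_mem_left (n : R) hs
      convert sub_mem (add_mem h2 h3) h1 using 1
      rcases n with _ | n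
      · simp; ring
      · simp only [map_sub, D.leibniz, D.leibniz_pow, hD, smul_eq_mul, nsmul_eq_mul, D.map_natCast,
          Nat.factorial_succ, Nat.cast_mul, Nat.add_sub_cancel]
        push_cast
        ring
  obtain ⟨s, hs⟩ := key N
  have h1 := add_mem hs (J.mul_mem_right s hN)
  rw [sub_add_cancel] at h1
  exact (Ideal.unit_mul_mem_iff_mem _
    (isUnit_natCast_of_charZero k (Nat.factorial_ne_zero N))).1 h1

namespace weightedIdeal

variable {l : ℕ} {z : R} {y : Fin l → R} {v : ℕ} {s : Fin l → ℕ} {n : ℕ}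

theorem cons_weight_le (hs : ∀ i, s i ≤ v) (i : Fin (l + 1)) :
    (Fin.cons v s : Fin (l + 1) → ℕ) i ≤ v :=
  Fin.cases (by simp) (fun i => by simpa using hs i) i

/-- An element all of whose Taylor coefficients in the direction of the coordinate `z` lie in the
correct weighted ideals lies in the weighted ideal. -/
theorem mem_cons_of_taylor (D : Derivation k R R) (hD : D z = 1) (hs : ∀ i, s i ≤ v) (hv : 0 < v)
    {f : R} (hf : ∀ j, D^[j] f ∈ weightedIdeal y s (n - j * v) ⊔ Ideal.span {z}) :
    f ∈ weightedIdeal (Fin.cons z y : Fin (l + 1) → R) (Fin.cons v s : Fin (l + 1) → ℕ) n := by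
  set M := weightedIdeal (Fin.cons z y : Fin (l + 1) → R) (Fin.cons v s : Fin (l + 1) → ℕ) with hM
  have hz : z ∈ M v := head_mem
  have hdM : ∀ {t a}, a ∈ M t → D a ∈ M (t - v) := fun ha => deriv D (cons_weight_le hs) ha
  -- Descending induction on the number `i` of derivatives: for `i = n` the required degree is
  -- already `0`.
  have key : ∀ j i, i + j = n → D^[i] f ∈ M (n - i * v) := by
    intro j
    induction j with
    | zero =>
      rintro i rfl
      have : i + 0 - i * v = 0 := Nat.sub_eq_zero_of_le (Nat.le_mul_of_pos_right _ hv)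
      rw [this, hM, zero]; trivial
    | succ j ih =>
      intro i hi
      have h1 := ih (i + 1) (by omega)
      rw [Function.iterate_succ_apply'] at h1
      have h0 := hf i
      generalize D^[i] f = g at h0 h1 ⊢
      obtain ⟨h, hh, q, hq, rfl⟩ := Submodule.mem_sup.1 h0
      obtain ⟨r, rfl⟩ := Ideal.mem_span_singleton'.1 hq
      have hh' : h ∈ M (n - i * v) := le_cons hh
      refine add_mem hh' ?_
      have e1 : n - i * v - v = n - (i + 1) * v := by rw [add_mul, one_mul, Nat.sub_sub]
      have h2 := hdM hh'
      rw [e1] at h2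
      -- Here `D^[i] f = h + r z` with `h` under control. Differentiating and using the bound on the
      -- next derivative isolates `r + z D r`, from which `r` is recovered.
      have h3 : r + z * D r ∈ M (n - (i + 1) * v) := by
        have := sub_mem h1 h2
        rw [map_add, add_sub_cancel_left, D.leibniz, hD] at this
        simpa [add_comm] using this
      have h4 : r ∈ M (n - (i + 1) * v) := by
        refine mem_of_add_mul_derivation_mem D hD ?_ (N := n - (i + 1) * v) ?_ h3
        · intro a ha
          exact anti (by omega) (mul_mem hz (hdM ha))
        · exact anti (Nat.le_mul_of_pos_right _ hv) (pow_mem hz _)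
      exact anti (by rw [← e1]; omega) (mul_mem h4 hz)
  simpa using key n 0 (Nat.zero_add n)

theorem mem_cons_iff_taylor {S : Type*} [CommRing S] (g : R →+* S) (hg : RingHom.ker g =
    Ideal.span {z}) (hsurj : Function.Surjective g)
    (D : Derivation k R R) (hD : D z = 1) (hs : ∀ i, s i ≤ v) (hv : 0 < v) {f : R} :
    f ∈ weightedIdeal (Fin.cons z y : Fin (l + 1) → R) (Fin.cons v s : Fin (l + 1) → ℕ) n ↔
      ∀ j, g (D^[j] f) ∈ weightedIdeal (g ∘ y) s (n - j * v) := by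
  have hz : g z = 0 := by
    rw [← RingHom.mem_ker, hg]; exact Ideal.mem_span_singleton_self z
  constructor
  · intro hf j
    rw [← map_cons (z := z) (v := v) g hz]
    exact Ideal.mem_map_of_mem _ (deriv_iterate D (cons_weight_le hs) hf j)
  · intro hf
    refine mem_cons_of_taylor D hD hs hv fun j => ?_
    have := hf j
    rw [← map, ← Ideal.mem_comap, Ideal.comap_map_of_surjective g hsurj] at this
    rwa [← hg]

/-- Multiplicativity of the order function of the filtration by weighted ideals. -/
def IsValuative {ι : Type*} [Fintype ι] (x : ι → R) (w : ι → ℕ) : Prop :=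
  ∀ s t : ℕ, ∀ f g : R, f ∉ weightedIdeal x w (s + 1) → g ∉ weightedIdeal x w (t + 1) →
    f * g ∉ weightedIdeal x w (s + t + 1)

theorem isValuative_of_isEmpty {ι : Type*} [Fintype ι] [IsEmpty ι] [IsDomain R] (x : ι → R)
    (w : ι → ℕ) : IsValuative x w := by
  intro s t f g
  simp only [eq_bot (x := x) (w := w) (Nat.succ_ne_zero _), Ideal.mem_bot]
  exact mul_ne_zero

theorem exists_exact_order {ι : Type*} [Fintype ι] {x : ι → R} {w : ι → ℕ} {f : R} {s : ℕ}
    (hf : f ∉ weightedIdeal x w (s + 1)) :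
    ∃ s' ≤ s, f ∈ weightedIdeal x w s' ∧ f ∉ weightedIdeal x w (s' + 1) := by
  classical
  have h : ∃ s', f ∉ weightedIdeal x w (s' + 1) := ⟨s, hf⟩
  refine ⟨Nat.find h, Nat.find_min' h hf, ?_, Nat.find_spec h⟩
  rcases hn : Nat.find h with _ | m
  · rw [zero]; trivial
  · by_contra hc
    have := Nat.find_min' h hc
    omega

/-- As in Gauss's lemma: for each factor take the first Taylor coefficient of exactly minimal order.
In the corresponding coefficient of the product, Leibniz leaves one binomial multiple of their
product, and every other term has higher order. -/
theorem IsValuative.cons {S : Type*} [CommRing S] [Algebra k S] (g : R →+* S) (hg : RingHom.ker g =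
    Ideal.span {z}) (hsurj : Function.Surjective g)
    (D : Derivation k R R) (hD : D z = 1) (hs : ∀ i, s i ≤ v) (hv : 0 < v)
    (h : IsValuative (g ∘ y) s) :
    IsValuative (Fin.cons z y : Fin (l + 1) → R) (Fin.cons v s : Fin (l + 1) → ℕ) := by
  classical
  intro a b f₁ f₂ h₁ h₂ hmem
  -- Passing to exact orders makes all Taylor coefficients of both factors lie in the expected
  -- degrees.
  obtain ⟨a', ha', hf₁, h₁⟩ := exists_exact_order h₁
  obtain ⟨b', hb', hf₂, h₂⟩ := exists_exact_order h₂
  replace hmem := anti (show a' + b' + 1 ≤ a + b + 1 by omega) hmem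
  rw [mem_cons_iff_taylor g hg hsurj D hD hs hv] at hf₁ hf₂ h₁ h₂ hmem
  push Not at h₁ h₂
  have m₁ := fun i => Nat.find_min h₁ (m := i)
  have m₂ := fun i => Nat.find_min h₂ (m := i)
  have s₁ := Nat.find_spec h₁
  have s₂ := Nat.find_spec h₂
  generalize Nat.find h₁ = i₀ at m₁ s₁
  generalize Nat.find h₂ = j₀ at m₂ s₂
  simp only [not_not] at m₁ m₂
  -- Beyond this range the truncated subtraction gives degree `0`, where the weighted ideal is
  -- everything.
  have p₁ : i₀ * v ≤ a' := by
    by_contra! hc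
    rw [Nat.sub_eq_zero_of_le hc, zero] at s₁
    exact s₁ trivial
  have p₂ : j₀ * v ≤ b' := by
    by_contra! hc
    rw [Nat.sub_eq_zero_of_le hc, zero] at s₂
    exact s₂ trivial
  have e₁ : a' + 1 - i₀ * v = (a' - i₀ * v) + 1 := by omega
  have e₂ : b' + 1 - j₀ * v = (b' - j₀ * v) + 1 := by omega
  rw [e₁] at s₁
  rw [e₂] at s₂
  refine h _ _ _ _ s₁ s₂ ?_
  have hsum := hmem (i₀ + j₀)
  have e₃ : a' + b' + 1 - (i₀ + j₀) * v = (a' - i₀ * v) + (b' - j₀ * v) + 1 := by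
    rw [add_mul]; omega
  rw [e₃, D.iterate_leibniz, map_sum, ← Finset.add_sum_erase _ _
    (Finset.HasAntidiagonal.mem_antidiagonal.2 (rfl : (i₀, j₀).1 + (i₀, j₀).2 = i₀ + j₀))] at hsum
  have hrest : ∑ ij ∈ (Finset.HasAntidiagonal.antidiagonal (i₀ + j₀)).erase (i₀, j₀),
      g ((i₀ + j₀).choose ij.1 • (D^[ij.1] f₁ * D^[ij.2] f₂)) ∈
      weightedIdeal (g ∘ y) s ((a' - i₀ * v) + (b' - j₀ * v) + 1) := by
    refine Submodule.sum_mem _ fun ij hij => ?_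
    obtain ⟨hne, hij⟩ := Finset.mem_erase.1 hij
    rw [Finset.HasAntidiagonal.mem_antidiagonal] at hij
    rw [map_nsmul, map_mul]
    refine Submodule.smul_of_tower_mem _ _ ?_
    have e₄ : ij.1 * v + ij.2 * v = i₀ * v + j₀ * v := by rw [← add_mul, hij, add_mul]
    rcases lt_trichotomy ij.1 i₀ with hlt | heq | hgt
    · exact anti (by omega) (mul_mem (m₁ _ hlt) (hf₂ ij.2))
    · exact absurd (Prod.ext heq (by simp only; omega)) hne
    · have hlt : ij.2 < j₀ := by omega
      exact anti (by omega) (mul_mem (hf₁ ij.1) (m₂ _ hlt))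
  have := sub_mem hsum hrest
  rw [add_sub_cancel_right, map_nsmul, map_mul, nsmul_eq_mul] at this
  exact (Ideal.unit_mul_mem_iff_mem _ (isUnit_natCast_of_charZero k
    (Nat.choose_pos (Nat.le_add_right i₀ j₀)).ne')).1 this

/-- Weighted ideals of a multiplicative order function are closed under extracting roots; this
recovers information on `I` from powers inside `C(I, a)`. -/
theorem IsValuative.mem_of_pow_mem {ι : Type*} [Fintype ι] {x : ι → R} {w : ι → ℕ}
    (h : IsValuative x w) {f : R} {e t : ℕ} (he : 0 < e) (hf : f ^ e ∈ weightedIdeal x w (e * t)) :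
    f ∈ weightedIdeal x w t := by
  rcases t with _ | t
  · rw [zero]; trivial
  by_contra hc
  have key : ∀ e : ℕ, 0 < e → f ^ e ∉ weightedIdeal x w (e * t + 1) := by
    intro e he
    induction e, he using Nat.le_induction with
    | base => simpa using hc
    | succ e he ih =>
      rw [pow_succ, add_mul, one_mul]
      exact h _ _ _ _ ih hc
  exact key e he (anti (by rw [mul_add]; omega) hf)

end weightedIdeal

end Taylor

/-! ### Order, dual derivations and regularity in local rings -/

section LocalRings

open IsLocalRing

theorem idealOrder_eq_natCast_iff {R : Type v} [CommRing R] {𝔪 I : Ideal R} {a : ℕ} :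
    idealOrder 𝔪 I = a ↔ I ≤ 𝔪 ^ a ∧ ¬ I ≤ 𝔪 ^ (a + 1) := by
  have hle : ∀ b : ℕ, I ≤ 𝔪 ^ b → (b : ℕ∞) ≤ idealOrder 𝔪 I := fun b hb =>
    le_iSup₂ (f := fun (a : ℕ) (_ : I ≤ 𝔪 ^ a) => (a : ℕ∞)) b hb
  constructor
  · intro h
    refine ⟨?_, fun hc => ?_⟩
    · by_contra hc
      have h1 : idealOrder 𝔪 I ≤ ((a - 1 : ℕ) : ℕ∞) := by
        refine iSup₂_le fun b hb => ?_
        have : b < a := by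
          by_contra! hab
          exact hc (hb.trans (Ideal.pow_le_pow_right hab))
        exact_mod_cast (by omega : b ≤ a - 1)
      have h2 : a ≠ 0 := by rintro rfl; simp at hc
      rw [h] at h1
      have : a ≤ a - 1 := by exact_mod_cast h1
      omega
    · have := hle _ hc
      rw [h] at this
      have : a + 1 ≤ a := by exact_mod_cast this
      omega
  · rintro ⟨h1, h2⟩
    refine le_antisymm (iSup₂_le fun b hb => ?_) (hle a h1)
    by_contra hc
    have hc : a < b := by exact_mod_cast not_le.1 hc
    exact h2 (hb.trans (Ideal.pow_le_pow_right hc))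

theorem Derivation.apply_mem_pow {k : Type u} [CommRing k] {R : Type v} [CommRing R] [Algebra k R]
    (D : Derivation k R R) (𝔪 : Ideal R) {j : ℕ} {f : R} (hf : f ∈ 𝔪 ^ (j + 1)) :
    D f ∈ 𝔪 ^ j := by
  induction j generalizing f with
  | zero => simp
  | succ j ih =>
    rw [pow_succ] at hf
    refine Submodule.mul_induction_on hf (fun a ha b hb => ?_) fun a b ha hb => ?_
    · rw [D.leibniz, smul_eq_mul, smul_eq_mul]
      refine add_mem (Ideal.mul_mem_right _ _ ha) ?_
      rw [pow_succ']
      exact Ideal.mul_mem_mul hb (ih ha)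
    · rw [map_add]; exact add_mem ha hb

theorem derivation_mem_derivIdeal {k : Type u} [CommRing k] {R : Type v} [CommRing R] [Algebra k R]
    (D : Derivation k R R) {I : Ideal R} {f : R} (hf : f ∈ I) : D f ∈ derivIdeal k I :=
  Ideal.subset_span (Or.inr ⟨D, f, hf, rfl⟩)

theorem iterate_derivation_mem {k : Type u} [CommRing k] {R : Type v} [CommRing R] [Algebra k R]
    (D : Derivation k R R) {I : Ideal R} {f : R} (hf : f ∈ I) (j : ℕ) :
    D^[j] f ∈ (derivIdeal k)^[j] I := by
  induction j with
  | zero => simpa using hf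
  | succ j ih =>
    rw [Function.iterate_succ_apply', Function.iterate_succ_apply']
    exact derivation_mem_derivIdeal D ih

theorem derivIdeal_le {k : Type u} [CommRing k] {R : Type v} [CommRing R] [Algebra k R]
    {I J : Ideal R} (h : I ≤ J) (hD : ∀ (D : Derivation k R R), ∀ f ∈ I, D f ∈ J) :
    derivIdeal k I ≤ J := by
  rw [derivIdeal, Ideal.span_le]
  rintro f (hf | ⟨D, g, hg, rfl⟩)
  · exact h hf
  · exact hD D g hg

/-- Every regular parameter of the local ring `R` is a coordinate of some `k`-derivation. For a
Noetherian local algebra over a field of characteristic zero this is a differential form of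
regularity. -/
def HasDualDerivations (k : Type u) [CommRing k] (R : Type v) [CommRing R] [Algebra k R]
    [IsLocalRing R] : Prop :=
  ∀ x ∈ maximalIdeal R, x ∉ maximalIdeal R ^ 2 → ∃ D : Derivation k R R, D x = 1

theorem Ideal.Quotient.mk_mem_map_iff {R : Type v} [CommRing R] {x : R} {I : Ideal R} {r : R} :
    Ideal.Quotient.mk (Ideal.span {x}) r ∈ I.map (Ideal.Quotient.mk (Ideal.span {x})) ↔
      r ∈ I ⊔ Ideal.span {x} := by
  rw [← Ideal.mem_comap, Ideal.comap_map_of_surjective' _ Ideal.Quotient.mk_surjective,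
    Ideal.mk_ker]

theorem Derivation.exists_apply_eq_one {k : Type u} [CommRing k] {R : Type v} [CommRing R] [Algebra k R]
    {D : Derivation k R R} {y : R} (h : IsUnit (D y)) :
    ∃ D' : Derivation k R R, D' y = 1 ∧ ∀ z, D z = 0 → D' z = 0 := by
  obtain ⟨u, hu⟩ := h
  refine ⟨(↑u⁻¹ : R) • D, ?_, fun z hz => ?_⟩
  · rw [Derivation.smul_apply, ← hu, smul_eq_mul, Units.inv_mul]
  · rw [Derivation.smul_apply, hz, smul_zero]

section Quotient

variable {k : Type u} [CommRing k] {R : Type v} [CommRing R] [Algebra k R] [IsLocalRing R] {x : R}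

theorem isLocalRing_quotient_span_singleton (hx : x ∈ maximalIdeal R) :
    IsLocalRing (R ⧸ Ideal.span {x}) := by
  have : Nontrivial (R ⧸ Ideal.span {x}) := by
    rw [Ideal.Quotient.nontrivial_iff]
    intro h
    rw [Ideal.span_singleton_eq_top] at h
    exact (mem_maximalIdeal x).1 hx h
  exact .of_surjective' (Ideal.Quotient.mk _) Ideal.Quotient.mk_surjective

variable [IsLocalRing (R ⧸ Ideal.span {x})]

theorem maximalIdeal_quotient_span_singleton (hx : x ∈ maximalIdeal R) :
    maximalIdeal (R ⧸ Ideal.span {x}) =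
      (maximalIdeal R).map (Ideal.Quotient.mk (Ideal.span {x})) := by
  symm
  apply eq_maximalIdeal
  refine (Ideal.map_eq_top_or_isMaximal_of_surjective _ Ideal.Quotient.mk_surjective
    (maximalIdeal.isMaximal R)).resolve_left fun h => ?_
  have h1 : Ideal.Quotient.mk (Ideal.span {x}) 1 ∈
      (maximalIdeal R).map (Ideal.Quotient.mk (Ideal.span {x})) := h ▸ trivial
  rw [Ideal.Quotient.mk_mem_map_iff, sup_eq_left.2 ((Ideal.span_singleton_le_iff_mem _).2 hx)] at h1
  exact (Ideal.ne_top_iff_one _).1 (maximalIdeal.isMaximal R).ne_top h1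

theorem mk_mem_maximalIdeal_iff (hx : x ∈ maximalIdeal R) {r : R} :
    Ideal.Quotient.mk (Ideal.span {x}) r ∈ maximalIdeal (R ⧸ Ideal.span {x}) ↔
      r ∈ maximalIdeal R := by
  rw [maximalIdeal_quotient_span_singleton hx, Ideal.Quotient.mk_mem_map_iff,
    sup_eq_left.2 ((Ideal.span_singleton_le_iff_mem _).2 hx)]

theorem mk_mem_maximalIdeal_sq_iff (hx : x ∈ maximalIdeal R) {r : R} :
    Ideal.Quotient.mk (Ideal.span {x}) r ∈ maximalIdeal (R ⧸ Ideal.span {x}) ^ 2 ↔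
      ∃ c, r - c * x ∈ maximalIdeal R ^ 2 := by
  rw [maximalIdeal_quotient_span_singleton hx, ← Ideal.map_pow, Ideal.Quotient.mk_mem_map_iff]
  constructor
  · intro h
    obtain ⟨a, ha, b, hb, rfl⟩ := Submodule.mem_sup.1 h
    obtain ⟨c, rfl⟩ := Ideal.mem_span_singleton'.1 hb
    exact ⟨c, by simpa using ha⟩
  · rintro ⟨c, hc⟩
    rw [← sub_add_cancel r (c * x)]
    exact add_mem (Ideal.mem_sup_left hc)
      (Ideal.mem_sup_right (Ideal.mul_mem_left _ _ (Ideal.mem_span_singleton_self x)))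

/-- A derivation descends to `V(x)` if it kills `x`. Lift the parameter to one on which the dual
derivation `D₁` of `x` is not a unit, and correct its own dual `D₂` by `D₂ x • D₁`: the result kills
`x` and is still a unit on the lift. -/
theorem HasDualDerivations.quotient (h : HasDualDerivations k R) (hx : x ∈ maximalIdeal R)
    (hx2 : x ∉ maximalIdeal R ^ 2) : HasDualDerivations k (R ⧸ Ideal.span {x}) := by
  intro y hy hy2
  obtain ⟨y, rfl⟩ := Ideal.Quotient.mk_surjective y
  rw [mk_mem_maximalIdeal_iff hx] at hy
  rw [mk_mem_maximalIdeal_sq_iff hx] at hy2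
  push Not at hy2
  obtain ⟨D₁, hD₁⟩ := h x hx hx2
  have hz : y - D₁ y * x ∈ maximalIdeal R := sub_mem hy (Ideal.mul_mem_left _ _ hx)
  obtain ⟨D₂, hD₂⟩ := h (y - D₁ y * x) hz (hy2 _)
  have hD₁z : D₁ (y - D₁ y * x) ∈ maximalIdeal R := by
    rw [map_sub, D₁.leibniz, hD₁]
    simpa using Ideal.mul_mem_right _ _ hx
  have hu : IsUnit ((D₂ - D₂ x • D₁) (y - D₁ y * x)) := by
    rw [Derivation.sub_apply, Derivation.smul_apply, hD₂, smul_eq_mul]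
    by_contra hc
    have hc : 1 - D₂ x * D₁ (y - D₁ y * x) ∈ maximalIdeal R := hc
    have := add_mem hc (Ideal.mul_mem_left _ (D₂ x) hD₁z)
    rw [sub_add_cancel] at this
    exact (Ideal.ne_top_iff_one _).1 (maximalIdeal.isMaximal R).ne_top this
  obtain ⟨D, hD, hD0⟩ := Derivation.exists_apply_eq_one hu
  have hDx : D x = 0 := hD0 x (by simp [hD₁])
  refine ⟨Derivation.liftOfSurjective (f := Ideal.Quotient.mkₐ k (Ideal.span {x}))
    (Ideal.Quotient.mkₐ_surjective _ _) (d := D) ?_, ?_⟩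
  · intro a ha
    rw [Ideal.Quotient.mkₐ_eq_mk, Ideal.Quotient.eq_zero_iff_mem] at ha ⊢
    obtain ⟨c, rfl⟩ := Ideal.mem_span_singleton'.1 ha
    rw [D.leibniz, hDx, smul_zero, zero_add]
    exact Ideal.mul_mem_right _ _ (Ideal.mem_span_singleton_self x)
  · have : Ideal.Quotient.mk (Ideal.span {x}) y =
        Ideal.Quotient.mkₐ k (Ideal.span {x}) (y - D₁ y * x) := by
      rw [Ideal.Quotient.mkₐ_eq_mk, eq_comm, Ideal.Quotient.eq]
      simpa using Ideal.mul_mem_left _ _ (Ideal.mem_span_singleton_self x)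
    rw [this, Derivation.liftOfSurjective_apply, hD, map_one]

end Quotient

section Field

variable {k : Type u} [Field k] [CharZero k] {R : Type v} [CommRing R] [Algebra k R]
  [IsLocalRing R] [IsNoetherianRing R] {x : R}

theorem exists_eq_pow_mul_of_ne_zero (hx : x ∈ maximalIdeal R) {f : R} (hf : f ≠ 0) :
    ∃ (p : ℕ) (g : R), f = x ^ p * g ∧ g ∉ Ideal.span {x} := by
  classical
  have hne : Ideal.span {x} ≠ ⊤ := fun h =>
    (mem_maximalIdeal x).1 hx (Ideal.span_singleton_eq_top.1 h)
  have h : ∃ p, f ∉ Ideal.span {x} ^ p := by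
    by_contra! hc
    refine hf ?_
    rw [← Ideal.mem_bot, ← Ideal.iInf_pow_eq_bot_of_isLocalRing _ hne]
    simpa using hc
  obtain ⟨p, hp, hp'⟩ : ∃ p, f ∈ Ideal.span {x} ^ p ∧ f ∉ Ideal.span {x} ^ (p + 1) := by
    rcases hn : Nat.find h with _ | p
    · have := Nat.find_spec h
      rw [hn] at this
      simp at this
    · refine ⟨p, ?_, hn ▸ Nat.find_spec h⟩
      by_contra hc
      have := Nat.find_min' h hc
      omega
  rw [Ideal.span_singleton_pow] at hp hp'
  obtain ⟨g, rfl⟩ := Ideal.mem_span_singleton.1 hp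
  refine ⟨p, g, rfl, fun hg => hp' ?_⟩
  obtain ⟨c, rfl⟩ := Ideal.mem_span_singleton.1 hg
  exact Ideal.mem_span_singleton.2 ⟨c, by ring⟩

/-- Differentiating `f * x = 0` gives `f + x D f = 0`. Hence `f` lies in every power of the ideal
`(x)`, and Krull's intersection theorem applies. -/
theorem mem_nonZeroDivisors_of_derivation (hx : x ∈ maximalIdeal R) {D : Derivation k R R}
    (hD : D x = 1) : x ∈ nonZeroDivisors R := by
  rw [mem_nonZeroDivisors_iff_right]
  intro f hf
  have key : ∀ N, f ∈ Ideal.span {x} ^ N := by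
    intro N
    rw [Ideal.span_singleton_pow]
    refine mem_of_add_mul_derivation_mem D hD (N := N) ?_ (Ideal.mem_span_singleton_self _) ?_
    · intro a ha
      obtain ⟨c, rfl⟩ := Ideal.mem_span_singleton.1 ha
      refine Ideal.mem_span_singleton.2 ⟨(N : R) * c + x * D c, ?_⟩
      rw [D.leibniz, D.leibniz_pow, hD]
      rcases N with _ | N
      · simp
      · simp
        ring
    · have := congrArg D hf
      rw [D.leibniz, hD, map_zero] at this
      simp only [smul_eq_mul, mul_one] at this
      rw [this]
      exact zero_mem _
  have hne : Ideal.span {x} ≠ ⊤ := fun h =>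
    (mem_maximalIdeal x).1 hx (Ideal.span_singleton_eq_top.1 h)
  rw [← Ideal.mem_bot, ← Ideal.iInf_pow_eq_bot_of_isLocalRing _ hne]
  simpa using key

theorem ringKrullDim_quotient_lt (hx : x ∈ maximalIdeal R) {D : Derivation k R R}
    (hD : D x = 1) {n : ℕ} (h : ringKrullDim R < (n + 1 : ℕ)) :
    ringKrullDim (R ⧸ Ideal.span {x}) < n := by
  have h1 := ringKrullDim_quotient_succ_le_of_nonZeroDivisor
    (mem_nonZeroDivisors_of_derivation hx hD)
  by_contra! hc
  have h2 : ((n + 1 : ℕ) : WithBot ℕ∞) ≤ ringKrullDim (R ⧸ Ideal.span {x}) + 1 := by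
    push_cast
    gcongr
  exact absurd (h.trans_le (h2.trans h1)) (lt_irrefl _)

theorem isDomain_of_isDomain_quotient (hx : x ∈ maximalIdeal R) {D : Derivation k R R}
    (hD : D x = 1) [IsDomain (R ⧸ Ideal.span {x})] : IsDomain R := by
  have hreg := mem_nonZeroDivisors_of_derivation hx hD
  have hp : (Ideal.span {x}).IsPrime := (Ideal.Quotient.isDomain_iff_prime _).1 inferInstance
  have : NoZeroDivisors R := by
    refine ⟨fun {a b} hab => ?_⟩
    by_contra! hc
    obtain ⟨p, f, rfl, hf⟩ := exists_eq_pow_mul_of_ne_zero hx hc.1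
    obtain ⟨q, g, rfl, hg⟩ := exists_eq_pow_mul_of_ne_zero hx hc.2
    have h1 : f * g * x ^ (p + q) = 0 := by rw [← hab]; ring
    have h2 := (mem_nonZeroDivisors_iff_right.1 (pow_mem hreg (p + q))) _ h1
    exact (hp.mem_or_mem (h2 ▸ zero_mem _ : f * g ∈ Ideal.span {x})).elim hf hg
  exact NoZeroDivisors.to_isDomain R

end Field

theorem exists_ringKrullDim_lt_natCast (R : Type v) [CommRing R] [IsLocalRing R]
    [IsNoetherianRing R] : ∃ n : ℕ, ringKrullDim R < n := by
  obtain ⟨d, hd⟩ := WithBot.ne_bot_iff_exists.1 (ringKrullDim_ne_bot (R := R))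
  have h := ringKrullDim_lt_top (R := R)
  rw [← hd] at h ⊢
  lift d to ℕ using by rintro rfl; exact lt_irrefl _ h
  exact ⟨d + 1, by exact_mod_cast Nat.lt_succ_self d⟩

/-- Induction on dimension: cutting by a regular parameter keeps the hypothesis, and the property of
being a domain lifts along the nonzerodivisor. Without regular parameters, Nakayama makes the ring a
field. -/
theorem HasDualDerivations.isDomain {k : Type u} [Field k] [CharZero k] {R : Type v} [CommRing R]
    [Algebra k R] [IsLocalRing R] [IsNoetherianRing R] (h : HasDualDerivations k R) :
    IsDomain R := by
  have key : ∀ (n : ℕ) (R : Type v) [CommRing R] [Algebra k R] [IsLocalRing R]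
      [IsNoetherianRing R], HasDualDerivations k R → ringKrullDim R < n → IsDomain R := by
    intro n
    induction n with
    | zero =>
      intro R _ _ _ _ _ hn
      exact absurd hn (not_lt.2 (by simpa using ringKrullDim_nonneg_of_nontrivial))
    | succ n ih =>
      intro R _ _ _ _ h hn
      by_cases hm : maximalIdeal R ≤ maximalIdeal R ^ 2
      · have hbot : maximalIdeal R = ⊥ := by
          refine Submodule.eq_bot_of_le_smul_of_le_jacobson_bot (maximalIdeal R) (maximalIdeal R)
            (IsNoetherian.noetherian _) ?_ (maximalIdeal_le_jacobson _)
          rwa [smul_eq_mul, ← sq]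
        exact (isField_iff_maximalIdeal_eq.2 hbot).isDomain
      · obtain ⟨x, hx, hx2⟩ := Set.not_subset.1 hm
        obtain ⟨D, hD⟩ := h x hx hx2
        have := isLocalRing_quotient_span_singleton hx
        have := ih (R ⧸ Ideal.span {x}) (h.quotient hx hx2) (ringKrullDim_quotient_lt hx hD hn)
        exact isDomain_of_isDomain_quotient hx hD
  obtain ⟨n, hn⟩ := exists_ringKrullDim_lt_natCast R
  exact key n R h hn


theorem Derivation.apply_mem_of_mem_smul_top {k : Type u} [CommRing k] {R : Type v} [CommRing R]
    [Algebra k R] {𝔪 : Ideal R} {E : Derivation k R R}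
    (hE : E ∈ 𝔪 • (⊤ : Submodule R (Derivation k R R))) {J : Ideal R} {z : R}
    (hJ : ∀ D : Derivation k R R, D z ∈ J) : E z ∈ 𝔪 * J := by
  induction hE using Submodule.smul_induction_on' with
  | smul r hr D _ =>
    rw [Derivation.smul_apply, smul_eq_mul]
    exact Ideal.mul_mem_mul hr (hJ D)
  | add D _ D' _ hD hD' =>
    rw [Derivation.add_apply]
    exact add_mem hD hD'

/-- A composite of derivations is in general not a derivation, but its second-order part vanishes
modulo `𝔪` when `E` has coefficients in `𝔪`. -/
theorem Derivation.exists_comp_sub_mem {k : Type u} [CommRing k] {R : Type v} [CommRing R]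
    [Algebra k R] {𝔪 : Ideal R} {E : Derivation k R R}
    (hE : E ∈ 𝔪 • (⊤ : Submodule R (Derivation k R R))) (D : Derivation k R R) :
    ∃ D' : Derivation k R R, ∀ z, D (E z) - D' z ∈ 𝔪 := by
  induction hE using Submodule.smul_induction_on' with
  | smul r hr D₁ _ =>
    refine ⟨D r • D₁, fun z => ?_⟩
    rw [Derivation.smul_apply, Derivation.smul_apply, smul_eq_mul, D.leibniz, smul_eq_mul,
      smul_eq_mul, smul_eq_mul, mul_comm (D₁ z), add_sub_cancel_right]
    exact Ideal.mul_mem_right _ _ hr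
  | add E₁ _ E₂ _ h₁ h₂ =>
    obtain ⟨D₁, h₁⟩ := h₁
    obtain ⟨D₂, h₂⟩ := h₂
    refine ⟨D₁ + D₂, fun z => ?_⟩
    convert add_mem (h₁ z) (h₂ z) using 1
    simp only [Derivation.add_apply, map_add]
    ring

section Euler

variable {k : Type u} [CommRing k] {R : Type v} [CommRing R] [Algebra k R] [IsLocalRing R]

/-- A derivation acting as a projection onto a subspace of the cotangent space can be modified to
one with a larger image. -/
theorem HasDualDerivations.exists_enlarge_projection (h : HasDualDerivations k R)
    {𝔞 : Ideal R} (h2 : maximalIdeal R ^ 2 ≤ 𝔞) {E : Derivation k R R}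
    (hE : E ∈ maximalIdeal R • (⊤ : Submodule R (Derivation k R R)))
    (hE1 : ∀ x ∈ 𝔞, E x - x ∈ maximalIdeal R ^ 2) (hE2 : ∀ x ∈ maximalIdeal R, E x ∈ 𝔞)
    {y : R} (hy : y ∈ maximalIdeal R) (hya : y ∉ 𝔞) :
    ∃ z ∈ maximalIdeal R, z ∉ 𝔞 ∧
      ∃ E' ∈ maximalIdeal R • (⊤ : Submodule R (Derivation k R R)),
        (∀ x ∈ 𝔞 ⊔ Ideal.span {z}, E' x - x ∈ maximalIdeal R ^ 2) ∧
          ∀ x ∈ maximalIdeal R, E' x ∈ 𝔞 ⊔ Ideal.span {z} := by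
  have hE𝔪 : ∀ z, E z ∈ maximalIdeal R := by
    intro z
    have := Derivation.apply_mem_of_mem_smul_top hE (J := ⊤) (z := z) fun _ => Submodule.mem_top
    rwa [Ideal.mul_top] at this
  have hsq : ∀ (D : Derivation k R R), ∀ z ∈ maximalIdeal R ^ 2, D z ∈ maximalIdeal R :=
    fun D z hz => by simpa using D.apply_mem_pow (maximalIdeal R) (j := 1) hz
  -- Subtracting the projection puts `z` in the kernel of `E` on the cotangent space. The correction
  -- `z • (D - D')` acts there as `x ↦ z · D (x - E x)`: zero on `𝔞`, the identity on `z`.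
  obtain ⟨z, hz⟩ : ∃ z, z = y - E y := ⟨_, rfl⟩
  have hz𝔪 : z ∈ maximalIdeal R := hz ▸ sub_mem hy (hE𝔪 y)
  have hza : z ∉ 𝔞 := fun hc => hya (by
    have := add_mem hc (hE2 y hy)
    rwa [hz, sub_add_cancel] at this)
  have hEz : E z ∈ maximalIdeal R ^ 2 := by
    rw [hz, map_sub, ← neg_sub]
    exact neg_mem (hE1 _ (hE2 y hy))
  obtain ⟨D, hD⟩ := h z hz𝔪 fun hc => hza (h2 hc)
  obtain ⟨D', hD'⟩ := Derivation.exists_comp_sub_mem hE D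
  have hDz : D' z ∈ maximalIdeal R := by
    have := sub_mem (hsq D _ hEz) (hD' z)
    rwa [sub_sub_cancel] at this
  have hE' : ∀ x, (E + z • (D - D')) x = E x + z * (D x - D' x) := fun x => by simp
  refine ⟨z, hz𝔪, hza, E + z • (D - D'), add_mem hE (Submodule.smul_mem_smul hz𝔪 Submodule.mem_top), ?_, ?_⟩
  · generalize E + z • (D - D') = E' at hE'
    intro x hx
    obtain ⟨a, ha, b, hb, rfl⟩ := Submodule.mem_sup.1 hx
    obtain ⟨r, rfl⟩ := Ideal.mem_span_singleton'.1 hb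
    have h1 : E' a - a ∈ maximalIdeal R ^ 2 := by
      rw [hE', add_sub_right_comm]
      refine add_mem (hE1 a ha) ?_
      rw [sq]
      refine Ideal.mul_mem_mul hz𝔪 ?_
      have := sub_mem (hD' a) (hsq D _ (hE1 a ha))
      rw [map_sub] at this
      convert this using 1
      ring
    have h3 : E' z - z ∈ maximalIdeal R ^ 2 := by
      rw [hE', hD]
      have : z * D' z ∈ maximalIdeal R ^ 2 := by rw [sq]; exact Ideal.mul_mem_mul hz𝔪 hDz
      convert sub_mem hEz this using 1
      ring
    have h4 : z * E' r ∈ maximalIdeal R ^ 2 := by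
      rw [sq]
      refine Ideal.mul_mem_mul hz𝔪 ?_
      rw [hE']
      exact add_mem (hE𝔪 r) (Ideal.mul_mem_right _ _ hz𝔪)
    rw [map_add, Derivation.leibniz, smul_eq_mul, smul_eq_mul]
    convert add_mem h1 (add_mem (Ideal.mul_mem_left _ r h3) h4) using 1
    ring
  · intro x hx
    rw [hE']
    exact add_mem (Ideal.mem_sup_left (hE2 x hx)) (Ideal.mem_sup_right
      (Ideal.mul_mem_right _ _ (Ideal.mem_span_singleton_self z)))

/-- There is a derivation inducing the identity on the cotangent space, like the Euler
derivation `∑ xᵢ ∂/∂xᵢ`. -/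
theorem HasDualDerivations.exists_euler [IsNoetherianRing R] (h : HasDualDerivations k R) :
    ∃ E ∈ maximalIdeal R • (⊤ : Submodule R (Derivation k R R)),
      ∀ x ∈ maximalIdeal R, E x - x ∈ maximalIdeal R ^ 2 := by
  -- Ideals containing `𝔪 ^ 2` stand for subspaces of the cotangent space. By the Noetherian
  -- condition some projection has maximal image, and enlarging it shows that this image is
  -- everything.
  let P : Set (Ideal R) := {𝔞 | maximalIdeal R ^ 2 ≤ 𝔞 ∧
    ∃ E ∈ maximalIdeal R • (⊤ : Submodule R (Derivation k R R)),
      (∀ x ∈ 𝔞, E x - x ∈ maximalIdeal R ^ 2) ∧ ∀ x ∈ maximalIdeal R, E x ∈ 𝔞}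
  have hP : maximalIdeal R ^ 2 ∈ P :=
    ⟨le_rfl, 0, zero_mem _, fun x hx => by simpa using hx, fun x _ => by simp⟩
  obtain ⟨𝔞, ⟨h2, E, hE, hE1, hE2⟩, hmax⟩ :=
    set_has_maximal_iff_noetherian.2 ‹IsNoetherianRing R› P ⟨_, hP⟩
  refine ⟨E, hE, fun y hy => hE1 y ?_⟩
  by_contra hya
  obtain ⟨z, hz, hza, hE'⟩ := h.exists_enlarge_projection h2 hE hE1 hE2 hy hya
  refine hmax (𝔞 ⊔ Ideal.span {z}) ⟨h2.trans le_sup_left, hE'⟩ ?_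
  refine lt_of_le_of_ne le_sup_left fun hc => hza ?_
  rw [hc]
  exact Ideal.mem_sup_right (Ideal.mem_span_singleton_self z)

/-- Euler's identity for homogeneous forms, on the leading term of `f`. -/
theorem euler_sub_natCast_mul_mem {E : Derivation k R R}
    (hE : ∀ x ∈ maximalIdeal R, E x - x ∈ maximalIdeal R ^ 2) {j : ℕ} {f : R}
    (hf : f ∈ maximalIdeal R ^ (j + 1)) :
    E f - (j + 1 : ℕ) * f ∈ maximalIdeal R ^ (j + 2) := by
  induction j generalizing f with
  | zero => simpa using hE f (by simpa using hf)
  | succ j ih =>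
    rw [pow_succ] at hf
    refine Submodule.mul_induction_on hf (fun a ha b hb => ?_) fun a b ha hb => ?_
    · have h1 : b * (E a - (j + 1 : ℕ) * a) ∈ maximalIdeal R ^ (j + 1 + 2) := by
        rw [show j + 1 + 2 = (j + 2) + 1 by ring, pow_succ']
        exact Ideal.mul_mem_mul hb (ih ha)
      have h2 : a * (E b - b) ∈ maximalIdeal R ^ (j + 1 + 2) := by
        rw [pow_add]
        exact Ideal.mul_mem_mul ha (hE b hb)
      convert add_mem h1 h2 using 1
      rw [E.leibniz]
      push_cast
      simp only [smul_eq_mul]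
      ring
    · convert add_mem ha hb using 1
      rw [map_add]
      ring

theorem derivIdeal_le_pow {J : Ideal R} {j : ℕ} (h1 : J ≤ maximalIdeal R ^ (j + 1)) :
    derivIdeal k J ≤ maximalIdeal R ^ j :=
  derivIdeal_le (h1.trans (Ideal.pow_le_pow_right (Nat.le_succ j)))
    fun D _ hf => D.apply_mem_pow _ (h1 hf)

end Euler

section Order

variable {k : Type u} [Field k] [CharZero k] {R : Type v} [CommRing R] [Algebra k R]
  [IsLocalRing R] [IsNoetherianRing R]

/-- In characteristic zero, `𝒟^{≤1}` lowers the order by exactly one. -/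
theorem HasDualDerivations.not_derivIdeal_le_pow (h : HasDualDerivations k R) {J : Ideal R} {j : ℕ}
    (h1 : J ≤ maximalIdeal R ^ (j + 1)) (h2 : ¬ J ≤ maximalIdeal R ^ (j + 2)) :
    ¬ derivIdeal k J ≤ maximalIdeal R ^ (j + 1) := by
  intro hc
  obtain ⟨E, hE, hE1⟩ := h.exists_euler
  refine h2 fun f hf => ?_
  have h3 : E f ∈ maximalIdeal R ^ (j + 2) := by
    rw [show j + 2 = (j + 1) + 1 by ring, pow_succ']
    exact Derivation.apply_mem_of_mem_smul_top hE fun D => hc (derivation_mem_derivIdeal D hf)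
  have h4 := sub_mem h3 (euler_sub_natCast_mul_mem hE1 (h1 hf))
  rw [sub_sub_cancel] at h4
  exact (Ideal.unit_mul_mem_iff_mem _ (isUnit_natCast_of_charZero k (Nat.succ_ne_zero j))).1 h4

/-- Existence of maximal contact elements. -/
theorem HasDualDerivations.exists_maximalContact (h : HasDualDerivations k R) {I : Ideal R} {a : ℕ}
    (ha : 1 ≤ a) (h1 : I ≤ maximalIdeal R ^ a) (h2 : ¬ I ≤ maximalIdeal R ^ (a + 1)) :
    ∃ x ∈ (derivIdeal k)^[a - 1] I, x ∈ maximalIdeal R ∧ x ∉ maximalIdeal R ^ 2 := by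
  -- Each application of `𝒟^{≤1}` lowers the order by exactly one, so after `a - 1` of them the
  -- order is `1`.
  have key : ∀ i j, i + j + 1 = a → (derivIdeal k)^[i] I ≤ maximalIdeal R ^ (j + 1) ∧
      ¬ (derivIdeal k)^[i] I ≤ maximalIdeal R ^ (j + 2) := by
    intro i
    induction i with
    | zero =>
      rintro j rfl
      simp only [Function.iterate_zero, id_eq]
      refine ⟨by simpa using h1, ?_⟩
      convert h2 using 3
      omega
    | succ i ih =>
      intro j hj
      obtain ⟨h3, h4⟩ := ih (j + 1) (by omega)
      rw [Function.iterate_succ_apply']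
      exact ⟨derivIdeal_le_pow h3, h.not_derivIdeal_le_pow h3 h4⟩
  obtain ⟨h3, h4⟩ := key (a - 1) 0 (by omega)
  obtain ⟨x, hx, hx2⟩ := Set.not_subset.1 h4
  exact ⟨x, hx, by simpa using h3 hx, by simpa using hx2⟩

end Order

end LocalRings

/-! ### Partial regular systems of parameters and the exchange lemma -/

section ParameterFamilies

open IsLocalRing

/-- A family of elements of the maximal ideal is part of a regular system of parameters if it is
linearly independent in the cotangent space. -/
def IsParameterFamily {R : Type v} [CommRing R] [IsLocalRing R] {ι : Type*} [Fintype ι]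
    (x : ι → R) : Prop :=
  (∀ i, x i ∈ maximalIdeal R) ∧
    ∀ r : ι → R, ∑ i, r i * x i ∈ maximalIdeal R ^ 2 → ∀ i, r i ∈ maximalIdeal R

namespace IsParameterFamily

variable {R : Type v} [CommRing R] [IsLocalRing R] {l : ℕ}

theorem comp_equiv {ι : Type*} [Fintype ι] {x : ι → R} (hx : IsParameterFamily x) (e : ι ≃ ι) :
    IsParameterFamily (x ∘ e) := by
  refine ⟨fun i => hx.1 _, fun r hr i => ?_⟩
  have := hx.2 (r ∘ e.symm) (by
    rw [← e.sum_comp]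
    simpa using hr) (e i)
  simpa using this

theorem notMem_sq {ι : Type*} [Fintype ι] {x : ι → R} (hx : IsParameterFamily x) (i : ι) :
    x i ∉ maximalIdeal R ^ 2 := by
  classical
  intro hi
  have := hx.2 (Pi.single i 1) (by simpa [Pi.single_apply] using hi) i
  rw [Pi.single_eq_same] at this
  exact (Ideal.ne_top_iff_one _).1 (maximalIdeal.isMaximal R).ne_top this

theorem cons_iff {z : R} (hz : z ∈ maximalIdeal R) (hz2 : z ∉ maximalIdeal R ^ 2)
    [IsLocalRing (R ⧸ Ideal.span {z})] {y : Fin l → R} :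
    IsParameterFamily (Fin.cons z y : Fin (l + 1) → R) ↔
      IsParameterFamily (Ideal.Quotient.mk (Ideal.span {z}) ∘ y) := by
  constructor
  · intro h
    refine ⟨fun i => ?_, fun r hr i => ?_⟩
    · rw [Function.comp_apply, mk_mem_maximalIdeal_iff hz]
      simpa using h.1 i.succ
    · choose r' hr' using fun i => Ideal.Quotient.mk_surjective (I := Ideal.span {z}) (r i)
      have e : ∑ i, r i * (Ideal.Quotient.mk (Ideal.span {z}) ∘ y) i =
          Ideal.Quotient.mk (Ideal.span {z}) (∑ i, r' i * y i) := by
        simp [hr']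
      rw [e, mk_mem_maximalIdeal_sq_iff hz] at hr
      obtain ⟨c, hc⟩ := hr
      have := h.2 (Fin.cons (-c) r') (by
        rw [Fin.sum_univ_succ]
        simp only [Fin.cons_zero, Fin.cons_succ]
        convert hc using 1
        ring) i.succ
      rw [← hr', mk_mem_maximalIdeal_iff hz]
      simpa using this
  · intro h
    have hy : ∀ i, y i ∈ maximalIdeal R := fun i => (mk_mem_maximalIdeal_iff hz).1 (h.1 i)
    refine ⟨fun i => Fin.cases (by simpa using hz) (fun i => by simpa using hy i) i,
      fun r hr => ?_⟩
    rw [Fin.sum_univ_succ] at hr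
    simp only [Fin.cons_zero, Fin.cons_succ] at hr
    have hsucc : ∀ i : Fin l, r i.succ ∈ maximalIdeal R := by
      intro i
      rw [← mk_mem_maximalIdeal_iff hz]
      refine h.2 (fun i => Ideal.Quotient.mk _ (r i.succ)) ?_ i
      have e : ∑ i : Fin l, Ideal.Quotient.mk (Ideal.span {z}) (r i.succ) *
          (Ideal.Quotient.mk (Ideal.span {z}) ∘ y) i =
          Ideal.Quotient.mk (Ideal.span {z}) (∑ i : Fin l, r i.succ * y i) := by
        simp
      rw [e, mk_mem_maximalIdeal_sq_iff hz]
      refine ⟨-r 0, ?_⟩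
      convert hr using 1
      ring
    refine Fin.cases ?_ hsucc
    have h1 : ∑ i : Fin l, r i.succ * y i ∈ maximalIdeal R ^ 2 :=
      Submodule.sum_mem _ fun i _ => by rw [sq]; exact Ideal.mul_mem_mul (hsucc i) (hy i)
    have h2 := sub_mem hr h1
    rw [add_sub_cancel_right] at h2
    by_contra hc
    exact hz2 ((Ideal.unit_mul_mem_iff_mem _ (by simpa using hc)).1 h2)

/-- Induction on the number of parameters: restrict to `V(x 0)`, the parameter of largest weight.
With no parameters left the claim is that the ring is a domain. -/
theorem isValuative {k : Type u} [Field k] [CharZero k] {l : ℕ} {R : Type v} [CommRing R]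
    [Algebra k R] [IsLocalRing R] [IsNoetherianRing R] (h : HasDualDerivations k R)
    {x : Fin l → R} (hx : IsParameterFamily x) {w : Fin l → ℕ} (hw : Antitone w)
    (hw0 : ∀ i, 0 < w i) : weightedIdeal.IsValuative x w := by
  induction l generalizing R with
  | zero =>
    have := h.isDomain
    exact weightedIdeal.isValuative_of_isEmpty x w
  | succ l ih =>
    have hz := hx.1 0
    have hz2 := hx.notMem_sq 0
    have := isLocalRing_quotient_span_singleton hz
    obtain ⟨D, hD⟩ := h _ hz hz2
    rw [← Fin.cons_self_tail x] at hx ⊢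
    rw [← Fin.cons_self_tail w]
    refine weightedIdeal.IsValuative.cons (k := k) (Ideal.Quotient.mk _) Ideal.mk_ker
      Ideal.Quotient.mk_surjective D hD (fun i => hw (Fin.zero_le _)) (hw0 0) ?_
    exact ih (h.quotient hz hz2) ((cons_iff hz hz2).1 hx)
      (fun i j hij => hw (Fin.succ_le_succ_iff.2 hij)) fun i => hw0 _

/-- An element of minimal weighted order `w 0` is, up to a unit, one of the parameters of weight
`w 0` plus monomials in the other parameters. -/
theorem exists_leading_parameter {x : Fin (l + 1) → R} (hx : IsParameterFamily x)
    {w : Fin (l + 1) → ℕ} (hw : Antitone w) (hw0 : ∀ i, 0 < w i) {z : R}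
    (hz : z ∈ weightedIdeal x w (w 0)) (hz2 : z ∉ maximalIdeal R ^ 2) :
    ∃ i, w i = w 0 ∧ ∃ u, IsUnit u ∧ z - u * x i ∈ Ideal.span {y | ∃ c : Fin (l + 1) → ℕ,
      c i = 0 ∧ w 0 ≤ ∑ i, c i * w i ∧ y = ∏ i, x i ^ c i} := by
  classical
  -- Monomials avoiding all parameters of the top weight `w 0` need at least two factors to reach
  -- weight `w 0`, so they cannot contribute to the linear part of `z`.
  let H : Ideal R := Ideal.span {y | ∃ c : Fin (l + 1) → ℕ,
    (∀ i, w i = w 0 → c i = 0) ∧ w 0 ≤ ∑ i, c i * w i ∧ y = ∏ i, x i ^ c i}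
  have hH2 : H ≤ maximalIdeal R ^ 2 := by
    refine Ideal.span_le.2 ?_
    rintro _ ⟨c, hc0, hc, rfl⟩
    have h1 : ∑ i, c i * w i ≤ ∑ i, c i * (w 0 - 1) := by
      refine Finset.sum_le_sum fun i _ => ?_
      by_cases hi : w i = w 0
      · simp [hc0 i hi]
      · have := hw (Fin.zero_le i)
        exact Nat.mul_le_mul_left _ (by omega)
    rw [← Finset.sum_mul] at h1
    have h2 : 2 ≤ ∑ i, c i := by
      by_contra! hlt
      have h3 : (∑ i, c i) * (w 0 - 1) ≤ 1 * (w 0 - 1) := Nat.mul_le_mul_right _ (by omega)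
      have := hw0 0
      omega
    refine Ideal.pow_le_pow_right h2 ?_
    rw [← Finset.prod_pow_eq_pow_sum]
    exact Ideal.prod_mem_prod fun i _ => Ideal.pow_mem_pow (hx.1 i) _
  have key : ∃ (u : Fin (l + 1) → R), (∀ i, w i ≠ w 0 → u i = 0) ∧ z - ∑ i, u i * x i ∈ H := by
    refine Submodule.span_induction (p := fun z _ => ∃ (u : Fin (l + 1) → R),
      (∀ i, w i ≠ w 0 → u i = 0) ∧ z - ∑ i, u i * x i ∈ H) (fun y hy => ?_)
      ⟨0, by simp, by simp⟩ (fun a b _ _ ha hb => ?_) (fun r a _ ha => ?_) hz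
    · obtain ⟨c, hc, rfl⟩ := hy
      by_cases h : ∃ i, w i = w 0 ∧ c i ≠ 0
      · obtain ⟨i, hi, hci⟩ := h
        have hdvd : x i ∣ ∏ i, x i ^ c i :=
          (dvd_pow_self _ hci).trans (Finset.dvd_prod_of_mem _ (Finset.mem_univ i))
        obtain ⟨q, hq⟩ := hdvd
        refine ⟨Pi.single i q, fun j hj => Pi.single_eq_of_ne (by rintro rfl; exact hj hi) _, ?_⟩
        rw [hq]
        simp [Pi.single_apply, mul_comm]
      · push Not at h
        refine ⟨0, by simp, ?_⟩
        have : ∏ i, x i ^ c i ∈ H := Ideal.subset_span ⟨c, h, hc, rfl⟩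
        simpa using this
    · obtain ⟨u, hu, hu'⟩ := ha
      obtain ⟨t, ht, ht'⟩ := hb
      refine ⟨u + t, fun i hi => by simp [hu i hi, ht i hi], ?_⟩
      convert add_mem hu' ht' using 1
      simp only [Pi.add_apply, add_mul, Finset.sum_add_distrib]
      ring
    · obtain ⟨u, hu, hu'⟩ := ha
      refine ⟨r • u, fun i hi => by simp [hu i hi], ?_⟩
      convert H.mul_mem_left r hu' using 1
      simp only [Pi.smul_apply, smul_eq_mul, mul_sub, Finset.mul_sum, mul_assoc]
  obtain ⟨u, hu, hzu⟩ := key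
  obtain ⟨i, hi⟩ : ∃ i, u i ∉ maximalIdeal R := by
    by_contra! hc
    refine hz2 ?_
    have h1 : ∑ i, u i * x i ∈ maximalIdeal R ^ 2 :=
      Submodule.sum_mem _ fun i _ => by rw [sq]; exact Ideal.mul_mem_mul (hc i) (hx.1 i)
    simpa using add_mem (hH2 hzu) h1
  have hwi : w i = w 0 := by
    by_contra hc
    exact hi (by rw [hu i hc]; exact zero_mem _)
  refine ⟨i, hwi, u i, by simpa using hi, ?_⟩
  rw [← Finset.add_sum_erase _ _ (Finset.mem_univ i)] at hzu
  have e : z - u i * x i = (z - (u i * x i + ∑ j ∈ Finset.univ.erase i, u j * x j)) +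
      ∑ j ∈ Finset.univ.erase i, u j * x j := by ring
  rw [e]
  refine add_mem (Ideal.span_mono ?_ hzu) (Submodule.sum_mem _ fun j hj => ?_)
  · rintro _ ⟨c, hc, h⟩
    exact ⟨c, hc i hwi, h⟩
  · by_cases hwj : w j = w 0
    · refine Ideal.mul_mem_left _ _ (Ideal.subset_span ⟨Pi.single j 1, ?_, ?_, ?_⟩)
      · exact Pi.single_eq_of_ne (Finset.ne_of_mem_erase hj).symm _
      · simp [Pi.single_apply, hwj]
      · simp [Pi.single_apply, pow_ite]
    · rw [hu j hwj, zero_mul]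
      exact zero_mem _

/-- A regular parameter of minimal weighted order can be made the first element of a system of
parameters with the same weights, without shrinking the weighted ideals. -/
theorem exchange {x : Fin (l + 1) → R} (hx : IsParameterFamily x)
    {w : Fin (l + 1) → ℕ} (hw : Antitone w) (hw0 : ∀ i, 0 < w i) {z : R}
    (hz : z ∈ weightedIdeal x w (w 0)) (hz2 : z ∉ maximalIdeal R ^ 2) :
    ∃ y : Fin l → R, IsParameterFamily (Fin.cons z y : Fin (l + 1) → R) ∧
      ∀ n, weightedIdeal x w n ≤ weightedIdeal (Fin.cons z y : Fin (l + 1) → R) w n := by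
  classical
  obtain ⟨i, hi, u, hu, hrest⟩ := hx.exists_leading_parameter hw hw0 hz hz2
  have hwσ : ∀ j, w (Equiv.swap 0 i j) = w j := by
    intro j
    rcases eq_or_ne j 0 with rfl | h0
    · rw [Equiv.swap_apply_left, hi]
    · rcases eq_or_ne j i with rfl | h1
      · rw [Equiv.swap_apply_right, hi]
      · rw [Equiv.swap_apply_of_ne_of_ne h0 h1]
  set σ := Equiv.swap 0 i with hσ
  have hσ0 : σ 0 = i := Equiv.swap_apply_left _ _
  let y : Fin l → R := fun j => x (σ j.succ)
  have hxσ : (Fin.cons (x i) y : Fin (l + 1) → R) = x ∘ σ := by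
    funext j
    refine Fin.cases ?_ (fun j => ?_) j
    · simp [hσ0]
    · simp [y]
  have hrest' : z - u * x i ∈ weightedIdeal y (w ∘ Fin.succ) (w 0) := by
    refine Ideal.span_le.2 ?_ hrest
    rintro _ ⟨c, hci, hc, rfl⟩
    refine Ideal.subset_span ⟨fun j => c (σ j.succ), ?_, ?_⟩
    · rw [← Equiv.sum_comp σ, Fin.sum_univ_succ, hσ0, hci, zero_mul, zero_add] at hc
      simpa only [hwσ, Function.comp_apply] using hc
    · rw [← Equiv.prod_comp σ, Fin.prod_univ_succ, hσ0, hci, pow_zero, one_mul]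
  refine ⟨y, ⟨?_, ?_⟩, fun n => weightedIdeal.le_of_mem (fun j => ?_) n⟩
  · refine fun j => Fin.cases ?_ (fun j => ?_) j
    · have := weightedIdeal.le_pow (j := 0) hx.1 (fun i => hw (Fin.zero_le i))
        (by simpa using hw0 0) hz
      simpa using this
    · simpa using hx.1 _
  · intro r hr
    -- Taking the ideal generated by `y` in place of `𝔪` in `le_pow` shows that the remainder is a
    -- linear combination of the `y j`.
    have h1 : z - u * x i ∈ Ideal.span (Set.range y) := by
      have := weightedIdeal.le_pow (j := 0) (x := y) (w := w ∘ Fin.succ) (W := w 0)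
        (𝔪 := Ideal.span (Set.range y)) (fun j => Ideal.subset_span ⟨j, rfl⟩)
        (fun j => hw (Fin.zero_le _)) (by simpa using hw0 0) hrest'
      simpa using this
    obtain ⟨t, ht⟩ := Ideal.mem_span_range_iff_exists_fun.1 h1
    have hp := hx.comp_equiv σ
    rw [← hxσ] at hp
    have h2 := hp.2 (Fin.cons (r 0 * u) fun j => r 0 * t j + r j.succ) (by
      rw [Fin.sum_univ_succ] at hr ⊢
      simp only [Fin.cons_zero, Fin.cons_succ] at hr ⊢
      convert hr using 1
      have : z = u * x i + ∑ j, t j * y j := by rw [ht]; ring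
      rw [this]
      simp only [add_mul, Finset.sum_add_distrib, mul_add, Finset.mul_sum, mul_assoc]
      ring)
    have h3 : r 0 ∈ maximalIdeal R := by
      have := h2 0
      rw [Fin.cons_zero] at this
      rwa [Ideal.mul_unit_mem_iff_mem _ hu] at this
    refine fun j => Fin.cases h3 (fun j => ?_) j
    have := sub_mem (h2 j.succ) (Ideal.mul_mem_right (t j) _ h3)
    simpa using this
  · have hcons : ∀ j : Fin l, y j ∈
        weightedIdeal (Fin.cons z y : Fin (l + 1) → R) w (w j.succ) := fun j => by
      simpa using weightedIdeal.self_mem (x := (Fin.cons z y : Fin (l + 1) → R)) (w := w) j.succ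
    rcases eq_or_ne j i with rfl | hji
    · have h1 : z ∈ weightedIdeal (Fin.cons z y : Fin (l + 1) → R) w (w j) := by
        rw [hi]
        simpa using weightedIdeal.self_mem (x := (Fin.cons z y : Fin (l + 1) → R)) (w := w) 0
      have h2 := sub_mem h1 (weightedIdeal.le_of_mem hcons _ (hi ▸ hrest'))
      rw [sub_sub_cancel] at h2
      exact (Ideal.unit_mul_mem_iff_mem _ hu).1 h2
    · obtain ⟨j', hj'⟩ := Fin.exists_succ_eq.2 (show σ j ≠ 0 by
        intro hc
        apply hji
        rw [← hσ0, ← hc, hσ, Equiv.swap_apply_self])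
      have e : x j = y j' := by
        simp only [y, hj', hσ, Equiv.swap_apply_self]
      rw [e, ← hwσ j, ← hj']
      exact hcons j'

end IsParameterFamily

end ParameterFamilies

/-! ### The lexicographic order -/

section Lex

/-- The lexicographic order on sequences, in which truncation makes a sequence larger. -/
def lexLE : List ℚ → List ℚ → Prop
  | _, [] => True
  | [], _ :: _ => False
  | b :: bs, c :: cs => b < c ∨ b = c ∧ lexLE bs cs

theorem lexLE_antisymm : ∀ {b c : List ℚ}, lexLE b c → lexLE c b → b = c
  | [], [], _, _ => rfl
  | _ :: _, [], _, h => h.elim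
  | [], _ :: _, h, _ => h.elim
  | b :: bs, c :: cs, h₁, h₂ => by
    rcases h₁ with h₁ | ⟨rfl, h₁⟩
    · rcases h₂ with h₂ | ⟨rfl, -⟩
      · exact absurd h₁ h₂.asymm
      · exact absurd h₁ (lt_irrefl _)
    · rcases h₂ with h₂ | ⟨-, h₂⟩
      · exact absurd h₂ (lt_irrefl _)
      · rw [lexLE_antisymm h₁ h₂]

theorem lexLE.map_mul {m : ℚ} (hm : 0 < m) : ∀ {b c : List ℚ}, lexLE b c →
    lexLE (b.map (fun q => m * q)) (c.map (fun q => m * q))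
  | [], [], _ => trivial
  | _ :: _, [], _ => trivial
  | [], _ :: _, h => h.elim
  | b :: bs, c :: cs, h => by
    rcases h with h | ⟨rfl, h⟩
    · exact Or.inl (mul_lt_mul_of_pos_left h hm)
    · exact Or.inr ⟨rfl, lexLE.map_mul hm h⟩

theorem List.map_mul_map_inv_mul {m : ℚ} (hm : m ≠ 0) (b : List ℚ) :
    (b.map (fun q => m⁻¹ * q)).map (fun q => m * q) = b := by
  simp [Function.comp_def, mul_inv_cancel_left₀ hm]

end Lex

/-! ### Coefficient ideals and multiplicative filtrations -/

section Filtration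

variable {R : Type v} [CommRing R] {N : ℕ → Ideal R}

theorem prod_pow_le_of_filtration (h0 : N 0 = ⊤) (hmul : ∀ m n, N m * N n ≤ N (m + n))
    {ι : Type*} (s : Finset ι) (J : ι → Ideal R) (b d : ι → ℕ) (hJ : ∀ i ∈ s, J i ≤ N (d i)) :
    ∏ i ∈ s, J i ^ b i ≤ N (∑ i ∈ s, d i * b i) := by
  classical
  have hpow : ∀ (K : Ideal R) (n e : ℕ), K ≤ N n → K ^ e ≤ N (n * e) := by
    intro K n e hK
    induction e with
    | zero => simp [h0]
    | succ e ih => rw [pow_succ, mul_add, mul_one]; exact (Ideal.mul_mono ih hK).trans (hmul _ _)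
  induction s using Finset.induction_on with
  | empty => simp [h0]
  | insert i s hi ih =>
    rw [Finset.prod_insert hi, Finset.sum_insert hi]
    exact (Ideal.mul_mono (hpow _ _ _ (hJ i (Finset.mem_insert_self i s)))
      (ih fun j hj => hJ j (Finset.mem_insert_of_mem hj))).trans (hmul _ _)

theorem coeffIdeal_le_of_filtration (h0 : N 0 = ⊤) (hanti : Antitone N)
    (hmul : ∀ m n, N m * N n ≤ N (m + n)) {k : Type u} [CommRing k] [Algebra k R] {I : Ideal R}
    {a e : ℕ} (hI : ∀ i < a, (derivIdeal k)^[i] I ≤ N ((a - i) * e)) :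
    coeffIdeal k I a ≤ N (a ! * e) := by
  refine iSup₂_le fun b hb => ?_
  refine (prod_pow_le_of_filtration h0 hmul Finset.univ _ b (fun i : Fin a => (a - (i : ℕ)) * e)
    fun i _ => hI i i.2).trans (hanti ?_)
  calc a ! * e ≤ (∑ i : Fin a, (a - (i : ℕ)) * b i) * e := Nat.mul_le_mul_right _ hb
    _ = _ := by
      rw [Finset.sum_mul]
      exact Finset.sum_congr rfl fun i _ => by ring

theorem pow_le_coeffIdeal {k : Type u} [CommRing k] [Algebra k R] (I : Ideal R) {a i n : ℕ}
    (hi : i < a) (hn : a ! ≤ (a - i) * n) : ((derivIdeal k)^[i] I) ^ n ≤ coeffIdeal k I a := by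
  classical
  refine le_trans (le_of_eq ?_) (le_iSup₂_of_le (Pi.single (⟨i, hi⟩ : Fin a) n) ?_ le_rfl)
  · rw [Finset.prod_eq_single (⟨i, hi⟩ : Fin a)]
    · simp
    · intro j _ hj
      simp [hj]
    · simp
  · simpa [Pi.single_apply] using hn

end Filtration

/-! ### Admissible centers, their powers, restrictions and extensions -/

section Invariant

open IsLocalRing

/-- The sequence `b` is the type of an `I`-admissible center: `I` consists of elements of weighted
order at least `1`, for a partial system of parameters with `x i` of weight `1 / b i`. -/
def IsAdmissible {R : Type v} [CommRing R] [IsLocalRing R] (I : Ideal R) (b : List ℚ) : Prop :=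
  ∃ (l N : ℕ) (x : Fin l → R) (w : Fin l → ℕ), 0 < N ∧ IsParameterFamily x ∧ Antitone w ∧
    (∀ i, 0 < w i) ∧ I ≤ weightedIdeal x w N ∧ b = List.ofFn fun i => (N : ℚ) / w i

/-- The sequence `b` is the largest type of an `I`-admissible center. -/
def IsMaxAdmissible {R : Type v} [CommRing R] [IsLocalRing R] (I : Ideal R) (b : List ℚ) : Prop :=
  IsAdmissible I b ∧ ∀ c, IsAdmissible I c → lexLE c b

theorem IsMaxAdmissible.unique {R : Type v} [CommRing R] [IsLocalRing R] {I : Ideal R}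
    {b c : List ℚ} (hb : IsMaxAdmissible I b) (hc : IsMaxAdmissible I c) : b = c :=
  lexLE_antisymm (hc.2 b hb.1) (hb.2 c hc.1)

theorem antitone_cons {l : ℕ} {s : Fin l → ℕ} {v : ℕ} (hs : Antitone s) (hv : ∀ i, s i ≤ v) :
    Antitone (Fin.cons v s : Fin (l + 1) → ℕ) := by
  intro i j
  refine Fin.cases (fun _ => ?_) (fun i => ?_) i
  · exact (weightedIdeal.cons_weight_le hv j)
  · refine Fin.cases (fun h => ?_) (fun j h => ?_) j
    · simp at h
    · simpa using hs (Fin.succ_le_succ_iff.1 h)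

theorem IsAdmissible.pow {R : Type v} [CommRing R] [IsLocalRing R] {I : Ideal R} {m : ℕ} (hm : 0 < m)
    {b : List ℚ} (hb : IsAdmissible I b) :
    IsAdmissible (I ^ m) (b.map fun c => (m : ℚ) * c) := by
  obtain ⟨l, N, x, w, hN, hx, hw, hw0, hI, rfl⟩ := hb
  refine ⟨l, m * N, x, w, Nat.mul_pos hm hN, hx, hw, hw0, ?_, ?_⟩
  · have := prod_pow_le_of_filtration (weightedIdeal.zero (x := x) (w := w))
      (fun _ _ => weightedIdeal.mul_le) {()} (fun _ => I) (fun _ => m) (fun _ => N) (by simpa)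
    simpa [mul_comm] using this
  · rw [List.map_ofFn]
    congr 1
    funext i
    simp only [Function.comp_apply, Nat.cast_mul]
    ring

section Powers

variable {k : Type u} [Field k] [CharZero k] {R : Type v} [CommRing R] [Algebra k R]
  [IsLocalRing R] [IsNoetherianRing R]

/-- Multiplying all weights by `m` turns degree `N` into degree `m * N`, so `f ^ m` in the old ideal
of degree `N` gives `f` in the new one by extracting a root. -/
theorem IsAdmissible.of_pow_le (h : HasDualDerivations k R) {I J : Ideal R} {m : ℕ} (hm : 0 < m)
    (hIJ : I ^ m ≤ J) {b : List ℚ} (hb : IsAdmissible J b) :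
    IsAdmissible I (b.map fun c => (m : ℚ)⁻¹ * c) := by
  obtain ⟨l, N, x, w, hN, hx, hw, hw0, hJ, rfl⟩ := hb
  have hw' : Antitone fun i => m * w i := fun i j hij => Nat.mul_le_mul_left _ (hw hij)
  have hw0' : ∀ i, 0 < m * w i := fun i => Nat.mul_pos hm (hw0 i)
  refine ⟨l, N, x, fun i => m * w i, hN, hx, hw', hw0', fun f hf => ?_, ?_⟩
  · refine (hx.isValuative (k := k) h hw' hw0').mem_of_pow_mem hm ?_
    rw [weightedIdeal.smul hm]
    exact hJ (hIJ (Ideal.pow_mem_pow hf m))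
  · rw [List.map_ofFn]
    congr 1
    funext i
    have : (w i : ℚ) ≠ 0 := by exact_mod_cast (hw0 i).ne'
    have : (m : ℚ) ≠ 0 := by exact_mod_cast hm.ne'
    simp only [Function.comp_apply, Nat.cast_mul]
    field_simp

theorem IsMaxAdmissible.of_pow_le (h : HasDualDerivations k R) {I J : Ideal R} {m : ℕ} (hm : 0 < m)
    (hIJ : I ^ m ≤ J) {b : List ℚ} (hb : IsMaxAdmissible I b)
    (hJ : IsAdmissible J (b.map fun c => (m : ℚ) * c)) :
    IsMaxAdmissible J (b.map fun c => (m : ℚ) * c) := by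
  refine ⟨hJ, fun c hc => ?_⟩
  have hm' : (0 : ℚ) < m := by exact_mod_cast hm
  have := (hb.2 _ (hc.of_pow_le h hm hIJ)).map_mul hm'
  rwa [List.map_mul_map_inv_mul hm'.ne'] at this

end Powers

theorem iterate_derivIdeal_le_weightedIdeal {k : Type u} [CommRing k] {R : Type v} [CommRing R]
    [Algebra k R] {l : ℕ} {x : Fin l → R} {w : Fin l → ℕ} {W N : ℕ}
    (hw : ∀ i, w i ≤ W) {I : Ideal R} (hI : I ≤ weightedIdeal x w N) (i : ℕ) :
    (derivIdeal k)^[i] I ≤ weightedIdeal x w (N - i * W) := by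
  induction i with
  | zero => simpa using hI
  | succ i ih =>
    rw [Function.iterate_succ_apply', add_mul, one_mul, ← Nat.sub_sub]
    exact derivIdeal_le (ih.trans (weightedIdeal.anti (Nat.sub_le _ _)))
      fun D _ hf => weightedIdeal.deriv D hw (ih hf)

theorem coeffIdeal_le_weightedIdeal {k : Type u} [CommRing k] {R : Type v} [CommRing R]
    [Algebra k R] {l : ℕ} {x : Fin l → R} {w : Fin l → ℕ} {W a : ℕ}
    (hw : ∀ i, w i ≤ W) {I : Ideal R} (hI : I ≤ weightedIdeal x w (a * W)) :
    coeffIdeal k I a ≤ weightedIdeal x w (a ! * W) :=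
  coeffIdeal_le_of_filtration weightedIdeal.zero (fun _ _ => weightedIdeal.anti)
    (fun _ _ => weightedIdeal.mul_le) fun i _ => by
      rw [Nat.sub_mul]
      exact iterate_derivIdeal_le_weightedIdeal hw hI i

theorem factorial_div_sub {a i : ℕ} (hi : i < a) : (a - i) * (a ! / (a - i)) = a ! :=
  Nat.mul_div_cancel' (Nat.dvd_factorial (by omega) (Nat.sub_le _ _))

section Restriction

variable {k : Type u} [CommRing k] {R : Type v} [CommRing R] [Algebra k R]
  [IsLocalRing R]

theorem iterate_derivIdeal_le_pow {I : Ideal R} {a : ℕ} (hI : I ≤ maximalIdeal R ^ a) (i : ℕ) :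
    (derivIdeal k)^[i] I ≤ maximalIdeal R ^ (a - i) := by
  induction i with
  | zero => simpa using hI
  | succ i ih =>
    rw [Function.iterate_succ_apply']
    rcases Nat.eq_zero_or_pos (a - i) with h | h
    · rw [show a - (i + 1) = 0 by omega, pow_zero, Ideal.one_eq_top]; exact le_top
    · refine derivIdeal_le_pow ?_
      rwa [show a - (i + 1) + 1 = a - i by omega]

theorem coeffIdeal_le_pow {I : Ideal R} {a : ℕ} (hI : I ≤ maximalIdeal R ^ a) :
    coeffIdeal k I a ≤ maximalIdeal R ^ a ! := by
  have := coeffIdeal_le_of_filtration (k := k) (N := fun n => maximalIdeal R ^ n) (I := I) (a := a)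
    (e := 1) (by simp) (fun _ _ h => Ideal.pow_le_pow_right h) (fun m n => (pow_add _ m n).ge)
    (fun i _ => by simpa using iterate_derivIdeal_le_pow hI i)
  simpa using this

/-- The types of admissible centers are bounded in terms of the restriction of the coefficient
ideal to any hypersurface of maximal contact. -/
theorem IsAdmissible.lexLE_of_restriction {I : Ideal R} {a : ℕ} (ha : 1 ≤ a)
    (h2 : ¬ I ≤ maximalIdeal R ^ (a + 1)) {x : R}
    (hxI : x ∈ (derivIdeal k)^[a - 1] I)
    (hx : x ∈ maximalIdeal R) (hx2 : x ∉ maximalIdeal R ^ 2)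
    [IsLocalRing (R ⧸ Ideal.span {x})] {b : List ℚ}
    (hb : ∀ c, IsAdmissible ((coeffIdeal k I a).map (Ideal.Quotient.mk (Ideal.span {x}))) c →
      lexLE c b)
    {c : List ℚ} (hc : IsAdmissible I c) :
    lexLE c ((a : ℚ) :: b.map (fun c => c / ((a - 1)! : ℚ))) := by
  obtain ⟨l, N, y, w, hN, hy, hw, hw0, hI, rfl⟩ := hc
  rcases l with _ | l
  · rw [weightedIdeal.eq_bot hN.ne'] at hI
    exact absurd (hI.trans bot_le) h2
  have hw0Q : (0 : ℚ) < w 0 := by exact_mod_cast hw0 0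
  have hW : ∀ i, w i ≤ w 0 := fun i => hw (Fin.zero_le i)
  have hNa : N ≤ a * w 0 := by
    by_contra! hlt
    exact h2 (hI.trans (weightedIdeal.le_pow hy.1 hW hlt))
  rw [List.ofFn_succ]
  -- The first entry of the type is `N / w 0 ≤ a`. A strict inequality settles the lexicographic
  -- comparison; equality leads to the restriction.
  rcases hNa.lt_or_eq with hlt | rfl
  · left
    rw [div_lt_iff₀ hw0Q]
    exact_mod_cast hlt
  right
  refine ⟨by push_cast; field_simp, ?_⟩
  -- Each of the `a - 1` derivations costs at most `w 0`, out of a total weight `a * w 0`.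
  have hxw : x ∈ weightedIdeal y w (w 0) := by
    have := iterate_derivIdeal_le_weightedIdeal hW hI (a - 1) hxI
    rwa [← Nat.sub_mul, Nat.sub_sub_self ha, one_mul] at this
  obtain ⟨y', hy', hle⟩ := hy.exchange hw hw0 hxw hx2
  have hC := (coeffIdeal_le_weightedIdeal (k := k) hW hI).trans (hle _)
  have hwt : Fin.cons (w 0) (Fin.tail w) = w := Fin.cons_self_tail w
  have hCmap := Ideal.map_mono (f := Ideal.Quotient.mk (Ideal.span {x})) hC
  rw [← hwt, weightedIdeal.map_cons _ (Ideal.Quotient.eq_zero_iff_mem.2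
    (Ideal.mem_span_singleton_self x)), hwt] at hCmap
  have hadm := hb _ ⟨l, a ! * w 0, _, Fin.tail w, Nat.mul_pos (Nat.factorial_pos a) (hw0 0),
    (IsParameterFamily.cons_iff hx hx2).1 hy', fun i j hij => hw (Fin.succ_le_succ_iff.2 hij),
    fun i => hw0 _, hCmap, rfl⟩
  have hpos : (0 : ℚ) < ((a - 1)! : ℕ) := by exact_mod_cast Nat.factorial_pos _
  have := hadm.map_mul (inv_pos.2 hpos)
  rw [List.map_ofFn] at this
  convert this using 2
  · funext i
    have e : (a ! : ℚ) = a * ((a - 1)! : ℕ) := by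
      exact_mod_cast (Nat.mul_factorial_pred (by omega)).symm
    simp only [Function.comp_apply, Fin.tail, Nat.cast_mul, e]
    field_simp
  · funext q
    rw [div_eq_inv_mul]

end Restriction

/-- An admissible center for the restriction of the coefficient ideal to a hypersurface of maximal
contact extends to an admissible center for the ideal. -/
theorem IsAdmissible.of_restriction {k : Type u} [Field k] [CharZero k] {R : Type v} [CommRing R]
    [Algebra k R] [IsLocalRing R] [IsNoetherianRing R] (h : HasDualDerivations k R) {I : Ideal R} {a : ℕ} (ha : 1 ≤ a)
    {x : R} (hx : x ∈ maximalIdeal R) (hx2 : x ∉ maximalIdeal R ^ 2)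
    [IsLocalRing (R ⧸ Ideal.span {x})] {b : List ℚ}
    (hb : IsAdmissible ((coeffIdeal k I a).map (Ideal.Quotient.mk (Ideal.span {x}))) b)
    (hhead : ∀ c ∈ b.head?, ((a ! : ℕ) : ℚ) ≤ c) :
    IsAdmissible I ((a : ℚ) :: b.map (fun c => c / ((a - 1)! : ℚ))) := by
  obtain ⟨l, N, y, w, hN, hy, hw, hw0, hI, rfl⟩ := hb
  obtain ⟨y, rfl⟩ : ∃ y' : Fin l → R, Ideal.Quotient.mk (Ideal.span {x}) ∘ y' = y := by
    choose y' hy' using fun i => Ideal.Quotient.mk_surjective (I := Ideal.span {x}) (y i)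
    exact ⟨y', funext hy'⟩
  obtain ⟨D, hD⟩ := h x hx hx2
  have hfac : 0 < a ! := Nat.factorial_pos a
  -- This is where the bound on the first entry is needed: the new parameter `x` must carry the
  -- largest weight.
  have hle : ∀ i, a ! * w i ≤ N := by
    intro i
    obtain ⟨l, rfl⟩ : ∃ l', l = l' + 1 := Nat.exists_eq_succ_of_ne_zero (by
      rintro rfl; exact i.elim0)
    have h1 : a ! * w 0 ≤ N := by
      have := hhead ((N : ℚ) / w 0) (by simp)
      rw [le_div_iff₀ (by exact_mod_cast hw0 0)] at this
      exact_mod_cast this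
    exact (Nat.mul_le_mul_left _ (hw (Fin.zero_le i))).trans h1
  have hw' : Antitone fun i => a ! * w i := fun i j hij => Nat.mul_le_mul_left _ (hw hij)
  have hw0' : ∀ i, 0 < a ! * w i := fun i => Nat.mul_pos hfac (hw0 i)
  -- With total degree `a * N`, weight `N` for `x` gives the entry `a`, and weight `a! * w i` gives
  -- `N / w i` divided by `(a-1)!`.
  refine ⟨l + 1, a * N, Fin.cons x y, Fin.cons N fun i => a ! * w i, Nat.mul_pos ha hN,
    (IsParameterFamily.cons_iff hx hx2).2 hy, antitone_cons hw' hle,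
    fun i => Fin.cases (by simpa using hN) (fun i => by simpa using hw0' i) i, fun f hf => ?_, ?_⟩
  · rw [weightedIdeal.mem_cons_iff_taylor (k := k) (Ideal.Quotient.mk _) Ideal.mk_ker
      Ideal.Quotient.mk_surjective D hD hle hN]
    intro j
    rw [← Nat.sub_mul]
    rcases le_or_gt a j with hj | hj
    · rw [Nat.sub_eq_zero_of_le hj, zero_mul, weightedIdeal.zero]; trivial
    have hn := factorial_div_sub hj
    have hn0 : 0 < a ! / (a - j) := Nat.pos_of_ne_zero fun hc => by
      rw [hc, mul_zero] at hn; omega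
    -- The Taylor coefficient raised to the power `a!/(a-j)` lies in the restricted coefficient
    -- ideal, whose weighted order is known.
    refine (hy.isValuative (k := k) (h.quotient hx hx2) hw' hw0').mem_of_pow_mem hn0 ?_
    rw [← mul_assoc, mul_comm _ (a - j), hn, weightedIdeal.smul hfac, ← map_pow]
    exact hI (Ideal.mem_map_of_mem _ (pow_le_coeffIdeal I hj hn.ge
      (Ideal.pow_mem_pow (iterate_derivation_mem D hf j) _)))
  · rw [List.ofFn_succ, List.map_ofFn]
    have hNQ : (N : ℚ) ≠ 0 := by exact_mod_cast hN.ne'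
    congr 1
    · simp [hNQ]
    · congr 1
      funext i
      have : (w i : ℚ) ≠ 0 := by exact_mod_cast (hw0 i).ne'
      have e : (a ! : ℚ) = a * ((a - 1)! : ℕ) := by
        exact_mod_cast (Nat.mul_factorial_pred (by omega)).symm
      have h1 : ((a - 1)! : ℚ) ≠ 0 := by exact_mod_cast (Nat.factorial_pos _).ne'
      have h2 : (a : ℚ) ≠ 0 := by exact_mod_cast (by omega : a ≠ 0)
      simp only [Function.comp_apply, Fin.cons_succ, Nat.cast_mul, e]
      field_simp

end Invariant

/-! ### The invariant in a local ring -/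

section LocalInvariant

open IsLocalRing

variable {k : Type u} [Field k] [CharZero k]

theorem map_quotient_ne_top {R : Type v} [CommRing R] [IsLocalRing R] {x : R}
    (hx : x ∈ maximalIdeal R) [IsLocalRing (R ⧸ Ideal.span {x})] {J : Ideal R}
    (hJ : J ≤ maximalIdeal R) : J.map (Ideal.Quotient.mk (Ideal.span {x})) ≠ ⊤ := by
  intro h
  have := Ideal.map_mono (f := Ideal.Quotient.mk (Ideal.span {x})) hJ
  rw [h, ← maximalIdeal_quotient_span_singleton hx, top_le_iff] at this
  exact (maximalIdeal.isMaximal _).ne_top this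

/-- The invariant computed with any choice of maximal contact elements is the largest type of an
admissible center. -/
theorem IsInvariantOf.isMaxAdmissible {R : Type v} [CommRing R] [Algebra k R] {𝔪 I : Ideal R}
    {l : List ℚ} (h : IsInvariantOf k R 𝔪 I l) : ∀ [IsLocalRing R] [IsNoetherianRing R],
    HasDualDerivations k R → 𝔪 = maximalIdeal R → I ≠ ⊤ →
    IsMaxAdmissible I l ∧ ∀ c ∈ l.head?, ∀ j : ℕ, I ≤ maximalIdeal R ^ j → (j : ℚ) ≤ c := by
  induction h with
  | zero 𝔪 =>
    intro _ _ _ _ _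
    refine ⟨⟨⟨0, 1, Fin.elim0, Fin.elim0, one_pos, ⟨fun i => i.elim0, fun _ _ i => i.elim0⟩,
      fun i => i.elim0, fun i => i.elim0, bot_le, by simp⟩, fun c _ => ?_⟩, by simp⟩
    cases c <;> trivial
  | unit 𝔪 =>
    intro _ _ _ _ h
    exact absurd rfl h
  | @step R _ _ 𝔪 I a x l ha hord hxI hx hx2 _ ih =>
    intro iL iN hR h𝔪 hI
    subst h𝔪
    have hloc := isLocalRing_quotient_span_singleton hx
    obtain ⟨h1, h2⟩ := idealOrder_eq_natCast_iff.1 hord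
    have hC : coeffIdeal k I a ≤ maximalIdeal R ^ a ! := coeffIdeal_le_pow h1
    have hC' := hC.trans (Ideal.pow_le_self (Nat.factorial_ne_zero a))
    obtain ⟨hmax, hhead⟩ := ih (hR.quotient hx hx2) (maximalIdeal_quotient_span_singleton hx).symm
      (map_quotient_ne_top hx hC')
    -- The bound on the first entry is carried through the induction for this step: `C(I, a)` lies
    -- in `𝔪 ^ a!`, so the restricted invariant starts with at least `a!` if it is nonempty.
    refine ⟨⟨hmax.1.of_restriction hR ha hx hx2 fun c hc => hhead c hc _ ?_, fun c hc =>
      hc.lexLE_of_restriction ha h2 hxI hx hx2 hmax.2⟩, ?_⟩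
    · rw [maximalIdeal_quotient_span_singleton hx, ← Ideal.map_pow]
      exact Ideal.map_mono hC
    · rintro c hc j hj
      simp only [List.head?_cons, Option.mem_def, Option.some.injEq] at hc
      subst hc
      by_contra! hlt
      have hlt : a < j := by exact_mod_cast hlt
      exact h2 (hj.trans (Ideal.pow_le_pow_right hlt))

theorem exists_isInvariantOf {R : Type v} [CommRing R] [Algebra k R] [IsLocalRing R]
    [IsNoetherianRing R] (hR : HasDualDerivations k R) (I : Ideal R) :
    ∃ l, IsInvariantOf k R (maximalIdeal R) I l := by
  have key : ∀ (n : ℕ) (R : Type v) [CommRing R] [Algebra k R] [IsLocalRing R]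
      [IsNoetherianRing R], HasDualDerivations k R → ringKrullDim R < n → ∀ I : Ideal R,
      ∃ l, IsInvariantOf k R (maximalIdeal R) I l := by
    intro n
    induction n with
    | zero =>
      intro R _ _ _ _ _ hn
      exact absurd hn (not_lt.2 (by simpa using ringKrullDim_nonneg_of_nontrivial))
    | succ n ih =>
      intro R _ _ _ _ hR hn I
      by_cases htop : I = ⊤
      · exact ⟨[0], htop ▸ IsInvariantOf.unit _⟩
      by_cases hbot : I = ⊥
      · exact ⟨[], hbot ▸ IsInvariantOf.zero _⟩
      obtain ⟨a, ha, h1, h2⟩ : ∃ a, 1 ≤ a ∧ I ≤ maximalIdeal R ^ a ∧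
          ¬ I ≤ maximalIdeal R ^ (a + 1) := by
        classical
        have hex : ∃ a, ¬ I ≤ maximalIdeal R ^ (a + 1) := by
          by_contra! hc
          refine hbot (le_bot_iff.1 ?_)
          rw [← Ideal.iInf_pow_eq_bot_of_isLocalRing _ (maximalIdeal.isMaximal R).ne_top]
          exact le_iInf fun i => (hc i).trans (Ideal.pow_le_pow_right (Nat.le_succ i))
        have hle := le_maximalIdeal htop
        refine ⟨Nat.find hex, ?_, ?_, Nat.find_spec hex⟩
        · by_contra! hc
          have := Nat.find_spec hex
          rw [Nat.lt_one_iff.1 hc] at this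
          simp [hle] at this
        · rcases hn : Nat.find hex with _ | m
          · simp
          · by_contra hc
            have := Nat.find_min' hex hc
            omega
      obtain ⟨x, hxI, hx, hx2⟩ := hR.exists_maximalContact ha h1 h2
      obtain ⟨D, hD⟩ := hR x hx hx2
      have := isLocalRing_quotient_span_singleton hx
      obtain ⟨l, hl⟩ := ih _ (hR.quotient hx hx2) (ringKrullDim_quotient_lt hx hD hn)
        ((coeffIdeal k I a).map (Ideal.Quotient.mk (Ideal.span {x})))
      rw [maximalIdeal_quotient_span_singleton hx] at hl
      exact ⟨_, .step _ _ a x l ha (idealOrder_eq_natCast_iff.2 ⟨h1, h2⟩) hxI hx hx2 hl⟩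
  obtain ⟨n, hn⟩ := exists_ringKrullDim_lt_natCast R
  exact key n R hR hn I

variable {R : Type v} [CommRing R] [Algebra k R] [IsLocalRing R] [IsNoetherianRing R]

theorem IsInvariantOf.eq_of_top {k : Type u} [CommRing k] {R : Type v} [CommRing R]
    [Algebra k R] [IsLocalRing R] {l : List ℚ}
    (h : IsInvariantOf k R (maximalIdeal R) ⊤ l) : l = [0] := by
  generalize hI : (⊤ : Ideal R) = I at h
  generalize h𝔪 : maximalIdeal R = 𝔪 at h
  cases h with
  | zero => exact absurd hI.symm bot_ne_top
  | unit => rfl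
  | step _ _ a x l ha hord hxI hx hx2 hl =>
    subst hI h𝔪
    have := (idealOrder_eq_natCast_iff.1 hord).1
    exact absurd (top_le_iff.1 (this.trans (Ideal.pow_le_self (by omega))))
      (maximalIdeal.isMaximal R).ne_top

theorem IsInvariantOf.head_eq {k : Type u} [CommRing k] {R : Type v} [CommRing R]
    [Algebra k R] [IsLocalRing R] {l : List ℚ} {I : Ideal R} {a : ℕ} (ha : 1 ≤ a)
    (hord : idealOrder (maximalIdeal R) I = a)
    (h : IsInvariantOf k R (maximalIdeal R) I l) : ∃ l', l = (a : ℚ) :: l' := by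
  generalize h𝔪 : maximalIdeal R = 𝔪 at h hord
  have hle := idealOrder_eq_natCast_iff.1 hord
  cases h with
  | zero => exact absurd bot_le hle.2
  | unit =>
    subst h𝔪
    exact absurd (top_le_iff.1 (hle.1.trans (Ideal.pow_le_self (by omega))))
      (maximalIdeal.isMaximal R).ne_top
  | step _ _ b x l hb hord' hxI hx hx2 hl =>
    rw [hord] at hord'
    have : a = b := by exact_mod_cast hord'
    exact ⟨_, by rw [this]⟩

/-- The unit ideal is excluded because it has no admissible center; its invariant is treated
separately. -/
theorem isInvariantOf_iff (hR : HasDualDerivations k R) {I : Ideal R} (hI : I ≠ ⊤) {l : List ℚ} :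
    IsInvariantOf k R (maximalIdeal R) I l ↔ IsMaxAdmissible I l := by
  refine ⟨fun h => (h.isMaxAdmissible hR rfl hI).1, fun h => ?_⟩
  obtain ⟨l', hl'⟩ := exists_isInvariantOf hR I
  rwa [h.unique (hl'.isMaxAdmissible hR rfl hI).1]

theorem IsInvariantOf.unique (hR : HasDualDerivations k R) {I : Ideal R} {l l' : List ℚ}
    (h : IsInvariantOf k R (maximalIdeal R) I l) (h' : IsInvariantOf k R (maximalIdeal R) I l') :
    l = l' := by
  by_cases hI : I = ⊤
  · subst hI
    rw [h.eq_of_top, h'.eq_of_top]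
  · exact (h.isMaxAdmissible hR rfl hI).1.unique (h'.isMaxAdmissible hR rfl hI).1

theorem IsInvariantOf.pow (hR : HasDualDerivations k R) {I : Ideal R} {l : List ℚ}
    (h : IsInvariantOf k R (maximalIdeal R) I l) {m : ℕ} (hm : 1 ≤ m) :
    IsInvariantOf k R (maximalIdeal R) (I ^ m) (l.map fun c => (m : ℚ) * c) := by
  by_cases hI : I = ⊤
  · subst hI
    rw [h.eq_of_top, ← Ideal.one_eq_top, one_pow, Ideal.one_eq_top]
    simpa using .unit _
  · have hI' : I ^ m ≠ ⊤ := fun hc => hI (top_le_iff.1 (hc ▸ Ideal.pow_le_self (by omega)))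
    rw [isInvariantOf_iff hR hI']
    have := (isInvariantOf_iff hR hI).1 h
    exact this.of_pow_le hR hm le_rfl (this.1.pow hm)

theorem IsInvariantOf.coeffIdeal (hR : HasDualDerivations k R) {I : Ideal R} {l : List ℚ}
    (h : IsInvariantOf k R (maximalIdeal R) I l) {a : ℕ} (ha : 1 ≤ a)
    (hord : idealOrder (maximalIdeal R) I = a) :
    IsInvariantOf k R (maximalIdeal R) (coeffIdeal k I a)
      (l.map fun c => ((a - 1)! : ℚ) * c) := by
  have hle := (idealOrder_eq_natCast_iff.1 hord).1
  have hne : ∀ {J : Ideal R}, J ≤ maximalIdeal R → J ≠ ⊤ := fun hJ hc =>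
    (maximalIdeal.isMaximal R).ne_top (top_le_iff.1 (hc ▸ hJ))
  have hC : _root_.coeffIdeal k I a ≤ maximalIdeal R :=
    (coeffIdeal_le_pow hle).trans (Ideal.pow_le_self (Nat.factorial_ne_zero a))
  have hmax := (isInvariantOf_iff hR (hne (hle.trans (Ideal.pow_le_self (by omega))))).1 h
  obtain ⟨l', rfl⟩ := h.head_eq ha hord
  rw [isInvariantOf_iff hR (hne hC)]
  have hfac := Nat.mul_factorial_pred (n := a) (by omega)
  -- The coefficient ideal contains `I ^ (a-1)!`, the monomial with only `b₀` nonzero. This bounds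
  -- its centers; what remains is to exhibit one of the rescaled type.
  refine hmax.of_pow_le hR (Nat.factorial_pos _) (J := _root_.coeffIdeal k I a) ?_ ?_
  · have := pow_le_coeffIdeal (k := k) I (a := a) (i := 0) (n := (a - 1)!) (by omega)
      (by simpa using hfac.ge)
    simpa using this
  · obtain ⟨n, N, x, w, hN, hx, hw, hw0, hI, hl⟩ := hmax.1
    rcases n with _ | n
    · simp at hl
    rw [hl, List.map_ofFn]
    rw [List.ofFn_succ] at hl
    -- The maximal type starts with `a`, so the bound of weighted orders under derivations applies
    -- with exactly this degree.
    have haN : N = a * w 0 := by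
      have h0 : (w 0 : ℚ) ≠ 0 := by exact_mod_cast (hw0 0).ne'
      have := (List.cons.inj hl).1
      rw [eq_div_iff h0] at this
      exact_mod_cast this.symm
    refine ⟨n + 1, (a - 1)! * N, x, w, Nat.mul_pos (Nat.factorial_pos _) hN, hx, hw, hw0, ?_, ?_⟩
    · have := coeffIdeal_le_weightedIdeal (k := k) (a := a) (fun i => hw (Fin.zero_le i))
        (haN ▸ hI)
      rwa [← hfac, mul_comm a, mul_assoc, ← haN] at this
    · congr 1
      funext i
      simp only [Function.comp_apply, Nat.cast_mul]
      ring

end LocalInvariant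

/-! ### Dual derivations on smooth local algebras -/

section SmoothLocal

open IsLocalRing TensorProduct

/-- In characteristic zero the residue field is formally smooth over `k`, so the cotangent space
injects into the fibre of the differentials. A regular parameter thus has nonzero differential
there, and since the differentials are free some coordinate of it is a unit. -/
theorem Algebra.FormallySmooth.hasDualDerivations (k : Type u) [Field k] [CharZero k] (R : Type v)
    [CommRing R] [Algebra k R] [IsLocalRing R] [Algebra.EssFiniteType k R]
    [Algebra.FormallySmooth k R] : HasDualDerivations k R := by
  intro x hx hx2
  have : Algebra.EssFiniteType k (ResidueField R) := .comp k R (ResidueField R)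
  have hsurj : Function.Surjective (algebraMap R (ResidueField R)) := residue_surjective
  obtain ⟨s, hs⟩ := (Algebra.FormallySmooth.iff_split_injection (R := k) hsurj).1 inferInstance
  have hker : RingHom.ker (algebraMap R (ResidueField R)) = maximalIdeal R := ker_residue
  have hx' : x ∈ RingHom.ker (algebraMap R (ResidueField R)) := hker ▸ hx
  have hne : (1 : ResidueField R) ⊗ₜ[R] KaehlerDifferential.D k R x ≠ 0 := by
    intro h0
    apply hx2
    have h1 : KaehlerDifferential.kerCotangentToTensor k R (ResidueField R)
      (Ideal.toCotangent _ ⟨x, hx'⟩) = 0 := h0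
    have h2 := LinearMap.congr_fun hs (Ideal.toCotangent _ ⟨x, hx'⟩)
    rw [LinearMap.comp_apply, h1, map_zero, LinearMap.id_apply, eq_comm,
      Ideal.toCotangent_eq_zero] at h2
    exact hker ▸ h2
  have : Module.Free R Ω[R⁄k] := Module.free_of_flat_of_isLocalRing
  let b := Module.Free.chooseBasis R Ω[R⁄k]
  obtain ⟨i, hi⟩ : ∃ i, b.repr (KaehlerDifferential.D k R x) i ∉ maximalIdeal R := by
    by_contra! hc
    apply hne
    rw [← b.linearCombination_repr (KaehlerDifferential.D k R x), Finsupp.linearCombination_apply,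
      Finsupp.sum, TensorProduct.tmul_sum]
    refine Finset.sum_eq_zero fun i _ => ?_
    rw [TensorProduct.tmul_smul, TensorProduct.smul_tmul', ← Algebra.algebraMap_eq_smul_one,
      ResidueField.algebraMap_eq, (residue_eq_zero_iff _).2 (hc i), TensorProduct.zero_tmul]
  obtain ⟨D, hD, -⟩ := Derivation.exists_apply_eq_one
    (D := (b.coord i).compDer (KaehlerDifferential.D k R)) (y := x) (by simpa using hi)
  exact ⟨D, hD⟩

end SmoothLocal

/-! ### Passage from ideal sheaves to stalks -/

section Stalks

variable {k : Type u} [Field k] {Y : Scheme.{u}}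

theorem map_germ_eq_of_le (I : Y.IdealSheafData) {p : Y} {V W : Y.affineOpens} (hle : W ≤ V)
    (hW : p ∈ W.1) (hV : p ∈ V.1) :
    (I.ideal W).map (Y.presheaf.germ W.1 p hW).hom =
      (I.ideal V).map (Y.presheaf.germ V.1 p hV).hom := by
  rw [← I.map_ideal hle, Ideal.map_map, ← CommRingCat.hom_comp]
  exact congrArg (fun g => (I.ideal V).map (CommRingCat.Hom.hom g))
    (Y.presheaf.germ_res (homOfLE (show W.1 ≤ V.1 from hle)) p hW)

/-- Two affine neighbourhoods of `p` share a basic open neighbourhood of `p`, so one affine chart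
computes the stalk and all operations reduce to localization. -/
theorem stalkIdeal_eq_map (I : Y.IdealSheafData) {p : Y} (U : Y.affineOpens) (hp : p ∈ U.1) :
    stalkIdeal I p = (I.ideal U).map (Y.presheaf.germ U.1 p hp).hom := by
  refine le_antisymm (iSup₂_le fun V hV => ?_) (le_iSup₂_of_le U hp le_rfl)
  obtain ⟨g, h, hgh, hpg⟩ := exists_basicOpen_le_affine_inter U.2 V.2 p ⟨hp, hV⟩
  have hUW : Y.affineBasicOpen g ≤ U := Y.basicOpen_le g
  have hVW : Y.affineBasicOpen g ≤ V := by
    change Y.basicOpen g ≤ V.1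
    rw [hgh]; exact Y.basicOpen_le h
  rw [← map_germ_eq_of_le I hVW hpg hV, ← map_germ_eq_of_le I hUW hpg hp]

theorem exists_affineOpens_mem (p : Y) : ∃ U : Y.affineOpens, p ∈ U.1 := by
  obtain ⟨_, ⟨U, hU, rfl⟩, hp, -⟩ :=
    Y.isBasis_affineOpens.exists_subset_of_mem_open (Set.mem_univ p) isOpen_univ
  exact ⟨⟨U, hU⟩, hp⟩

theorem stalkIdeal_pow (I : Y.IdealSheafData) (p : Y) (n : ℕ) :
    stalkIdeal (I ^ n) p = stalkIdeal I p ^ n := by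
  obtain ⟨U, hp⟩ := exists_affineOpens_mem p
  rw [stalkIdeal_eq_map _ U hp, stalkIdeal_eq_map _ U hp, Scheme.IdealSheafData.ideal_pow,
    Pi.pow_apply, Ideal.map_pow]

theorem stalkIdeal_mul (I J : Y.IdealSheafData) (p : Y) :
    stalkIdeal (I * J) p = stalkIdeal I p * stalkIdeal J p := by
  obtain ⟨U, hp⟩ := exists_affineOpens_mem p
  rw [stalkIdeal_eq_map _ U hp, stalkIdeal_eq_map _ U hp, stalkIdeal_eq_map _ U hp,
    Scheme.IdealSheafData.ideal_mul, Pi.mul_apply, Ideal.map_mul]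

theorem stalkIdeal_one (p : Y) : stalkIdeal (1 : Y.IdealSheafData) p = 1 := by
  obtain ⟨U, hp⟩ := exists_affineOpens_mem p
  rw [stalkIdeal_eq_map _ U hp, Scheme.IdealSheafData.one_eq_top,
    Scheme.IdealSheafData.ideal_top, Pi.top_apply, Ideal.map_top, Ideal.one_eq_top]

theorem stalkIdeal_iSup {ι : Sort*} (I : ι → Y.IdealSheafData) (p : Y) :
    stalkIdeal (⨆ i, I i) p = ⨆ i, stalkIdeal (I i) p := by
  obtain ⟨U, hp⟩ := exists_affineOpens_mem p
  rw [← iSup_plift_down, ← iSup_plift_down (f := fun i => stalkIdeal (I i) p)]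
  simp only [stalkIdeal_eq_map _ U hp, Scheme.IdealSheafData.ideal_iSup, iSup_apply,
    Ideal.map_iSup]

theorem stalkIdeal_prod {ι : Type*} (s : Finset ι) (I : ι → Y.IdealSheafData) (p : Y) :
    stalkIdeal (∏ i ∈ s, I i) p = ∏ i ∈ s, stalkIdeal (I i) p := by
  classical
  induction s using Finset.induction_on with
  | empty => simp only [Finset.prod_empty, stalkIdeal_one]
  | insert i s hi ih => rw [Finset.prod_insert hi, Finset.prod_insert hi, stalkIdeal_mul, ih]

variable (f : Y ⟶ Spec (.of k))

theorem sections_smooth [Smooth f] (U : Y.affineOpens) :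
    letI := sectionsAlgebra f U.1
    Algebra.Smooth k Γ(Y, U) :=
  RingHom.Smooth.respectsIso.2 (f.appLE ⊤ U.1 le_top).hom
    (Scheme.ΓSpecIso (.of k)).symm.commRingCatIsoToRingEquiv
    (Scheme.Hom.smooth_appLE f (isAffineOpen_top _) U.2 le_top)

theorem isScalarTower_sections_stalk (U : Y.affineOpens) {p : Y} (hp : p ∈ U.1) :
    letI := sectionsAlgebra f U.1
    letI := stalkAlgebra f p
    letI := (Y.presheaf.germ U.1 p hp).hom.toAlgebra
    IsScalarTower k Γ(Y, U) (Y.presheaf.stalk p) := by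
  let := sectionsAlgebra f U.1
  let := stalkAlgebra f p
  let := (Y.presheaf.germ U.1 p hp).hom.toAlgebra
  refine .of_algebraMap_eq' ?_
  simp only [RingHom.algebraMap_toAlgebra]
  rw [← CommRingCat.hom_comp, Category.assoc, Category.assoc, Y.presheaf.germ_res]

theorem isLocalization_stalk_of_mem (U : Y.affineOpens) {p : Y} (hp : p ∈ U.1) :
    letI := (Y.presheaf.germ U.1 p hp).hom.toAlgebra
    IsLocalization (U.2.primeIdealOf ⟨p, hp⟩).asIdeal.primeCompl (Y.presheaf.stalk p) :=
  U.2.isLocalization_stalk ⟨p, hp⟩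

theorem stalkIdeal_derivSheaf [Smooth f] (I : Y.IdealSheafData) (p : Y) :
    letI := stalkAlgebra f p
    stalkIdeal (derivSheaf f I) p = derivIdeal k (stalkIdeal I p) := by
  obtain ⟨U, hp⟩ := exists_affineOpens_mem p
  rw [stalkIdeal_eq_map _ U hp, stalkIdeal_eq_map _ U hp]
  let := sectionsAlgebra f U.1
  let := stalkAlgebra f p
  let := (Y.presheaf.germ U.1 p hp).hom.toAlgebra
  have := sections_smooth f U
  have := isScalarTower_sections_stalk f U hp
  have := isLocalization_stalk_of_mem U hp
  exact derivIdeal_map k (U.2.primeIdealOf ⟨p, hp⟩).asIdeal.primeCompl (I.ideal U)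

theorem stalkIdeal_coeffSheaf [Smooth f] (I : Y.IdealSheafData) (a : ℕ) (p : Y) :
    letI := stalkAlgebra f p
    stalkIdeal (coeffSheaf f I a) p = coeffIdeal k (stalkIdeal I p) a := by
  let := stalkAlgebra f p
  have hiter : ∀ i, stalkIdeal ((derivSheaf f)^[i] I) p = (derivIdeal k)^[i] (stalkIdeal I p) := by
    intro i
    induction i with
    | zero => rfl
    | succ i ih => rw [Function.iterate_succ_apply', Function.iterate_succ_apply',
        stalkIdeal_derivSheaf, ih]
  simp only [coeffSheaf, coeffIdeal, gradedPiece, stalkIdeal_iSup, stalkIdeal_prod, stalkIdeal_pow,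
    hiter]

theorem stalk_isNoetherianRing_and_hasDualDerivations [CharZero k] [Smooth f] (p : Y) :
    letI := stalkAlgebra f p
    IsNoetherianRing (Y.presheaf.stalk p) ∧ HasDualDerivations k (Y.presheaf.stalk p) := by
  obtain ⟨U, hp⟩ := exists_affineOpens_mem p
  let := sectionsAlgebra f U.1
  let := stalkAlgebra f p
  let := (Y.presheaf.germ U.1 p hp).hom.toAlgebra
  have := sections_smooth f U
  have := isScalarTower_sections_stalk f U hp
  have := isLocalization_stalk_of_mem U hp
  have : Algebra.EssFiniteType Γ(Y, U) (Y.presheaf.stalk p) :=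
    .of_isLocalization _ (U.2.primeIdealOf ⟨p, hp⟩).asIdeal.primeCompl
  have : Algebra.FormallySmooth Γ(Y, U) (Y.presheaf.stalk p) :=
    .of_isLocalization (U.2.primeIdealOf ⟨p, hp⟩).asIdeal.primeCompl
  have : Algebra.EssFiniteType k (Y.presheaf.stalk p) := .comp k Γ(Y, U) _
  have : Algebra.FormallySmooth k (Y.presheaf.stalk p) := .comp k Γ(Y, U) _
  exact ⟨Algebra.EssFiniteType.isNoetherianRing k _,
    Algebra.FormallySmooth.hasDualDerivations k _⟩

end Stalks

theorem mainTheorem8 {k : Type u} [Field k] [CharZero k] {Y : Scheme.{u}}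
    (f : Y ⟶ Spec (.of k)) [Smooth f] (I : Y.IdealSheafData) (p : Y) :
    (∃! l : List ℚ, IsInvariantAt f I p l) ∧
    (∀ m : ℕ, 1 ≤ m → invAt f (I ^ m) p = (invAt f I p).map (fun c => (m : ℚ) * c)) ∧
    (∀ a : ℕ, 1 ≤ a → orderAt I p = a →
      invAt f (coeffSheaf f I a) p = (invAt f I p).map (fun c => ((a - 1)! : ℚ) * c)) := by
  let := stalkAlgebra f p
  obtain ⟨hN, hR⟩ := stalk_isNoetherianRing_and_hasDualDerivations f p
  have hex : ∀ J : Y.IdealSheafData, ∃ l, IsInvariantAt f J p l := fun J =>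
    exists_isInvariantOf hR (stalkIdeal J p)
  have hspec : ∀ J : Y.IdealSheafData, IsInvariantAt f J p (invAt f J p) := fun J =>
    Classical.epsilon_spec (hex J)
  have huniq : ∀ (J : Y.IdealSheafData) {l l' : List ℚ}, IsInvariantAt f J p l →
      IsInvariantAt f J p l' → l = l' := fun J _ _ h h' => IsInvariantOf.unique hR h h'
  refine ⟨⟨invAt f I p, hspec I, fun l hl => huniq I hl (hspec I)⟩, fun m hm => ?_,
    fun a ha hord => ?_⟩
  · refine huniq _ (hspec _) ?_
    have := IsInvariantOf.pow hR (hspec I) hm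
    rwa [← stalkIdeal_pow] at this
  · refine huniq _ (hspec _) ?_
    have := IsInvariantOf.coeffIdeal hR (hspec I) ha hord
    rwa [← stalkIdeal_coeffSheaf] at this
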